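/- **Proposition 6.4.** For real sequences write $f_n\preceq g_n$ (or $g_n\succeq f_n$) if $\limsup_{n\to\infty} f_n/g_n<\infty$, and $f_n\approx g_n$ if $f_n\preceq g_n$ and $g_n\preceq f_n$. For a map $T:E\to F$ between (quasi-)normed spaces and $n\ge 1$ let $$e_n(T):=\inf\{\varepsilon>0 \mid \exists\, y_1,\dots,y_{2^{n-1}}\in F\ \ \forall z\in E,\ \|z\|\le 1,\ \exists\, i\le 2^{n-1}:\ \|T(z)-y_i\|\le\varepsilon\}$$ be the dyadic entropy numbers. Let $0<\alpha<2$. Let $(d_k)_{k\ge1}$ be a positive, increasing (i.e. non-decreasing) sequence such that $$d_n\approx d_{2n},\qquad \sum_{k=1}^\infty \frac{d_k^{-\alpha}}{k}=\infty,\qquad d_k\succeq(\log k)^{1/(2\alpha)}.$$ Then for every $p\in[1,\infty)$ there is a probability measure $\sigma$ on $\mathbb N$, with positive and non-increasing weights $\sigma_k=\sigma(\{k\})$, such that the embedding $u:\ell_p\to L_\alpha(\mathbb N,\sigma)$, $(z_k)\mapsto(k\mapsto z_k)$, has the following property. Let $(V_j)_{j\ge1}$ be i.i.d. $\mathbb N$-valued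 random variables with law $\sigma$ and $(\zeta_j)_{j\ge1}$ i.i.d. standard exponential random variables, the two sequences being independent of each other and defined on an arbitrary probability space $(\Omega,\mathbb Q)$. Put $\Gamma_j=\zeta_1+\dots+\zeta_j$ and let $v$ be the random operator $$v:\ell_p\to\ell_2,\qquad v(z)=c_\alpha\,\sigma(\mathbb N)^{1/\alpha}\,\bigl(z_{V_j}\,\Gamma_j^{-1/\alpha}\bigr)_{j\ge1},\qquad c_\alpha=\sqrt2\,\Bigl(\int_0^\infty x^{-\alpha}\sin x\,dx\Bigr)^{-1/\alpha}\bigl(\mathbf E|\xi|^\alpha\bigr)^{-1/\alpha},$$ where $\xi$ is standard normal and the integral is improper. Then, $\mathbb Q$-almost surely, $v$ is well defined (i.e. $v(z)\in\ell_2$ for all $z\in\ell_p$) and the entropy gap $$\mathcal G_n(u):=\frac{e_n(v)}{n^{-1/\alpha+1/2}\,e_n(u)}$$ satisfies $\mathcal G_n(u)\succeq d_n$. -/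

import Mathlib

open MeasureTheory ProbabilityTheory Filter Topology Asymptotics
open scoped ENNReal

noncomputable section

/-- The `n`-th dyadic entropy number (`n ≥ 1`) of a map `T : E → F` between (quasi-)normed spaces:
the infimum of all `ε > 0` such that the image of the closed unit ball of `E` is covered by
`2 ^ (n - 1)` closed balls of radius `ε` with centres in `F`. -/
def entropyNumber {E F : Type*} [Norm E] [Norm F] [Sub F] (T : E → F) (n : ℕ) : ℝ :=
  sInf {ε : ℝ | 0 < ε ∧ ∃ y : Fin (2 ^ (n - 1)) → F,
    ∀ z : E, ‖z‖ ≤ 1 → ∃ i, ‖T z - y i‖ ≤ ε}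

/-- The real sequence space `ℓ_p`. -/
abbrev SeqLp (p : ℝ≥0∞) : Type := lp (fun _ : ℕ => ℝ) p

/-- Every element of `ℓ_p` is a bounded sequence, hence lies in `L_α(ℕ, σ)` for finite `σ`. -/
theorem SeqLp.memLp {p : ℝ≥0∞} (α : ℝ) (σ : Measure ℕ) [IsFiniteMeasure σ] (z : SeqLp p) :
    MemLp (fun k : ℕ => z k) (ENNReal.ofReal α) σ := by
  have h : Memℓp (fun k : ℕ => z k) ∞ := (lp.memℓp z).of_exponent_ge le_top
  obtain ⟨C, hC⟩ := memℓp_infty_iff.1 h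
  exact MemLp.of_bound (measurable_of_countable _).aestronglyMeasurable C
    (ae_of_all _ fun k => hC ⟨k, rfl⟩)

/-- The embedding `u : ℓ_p → L_α(ℕ, σ)`, mapping the sequence `z` to the function `k ↦ z k`.
For `0 < α < 1` the space `L_α(ℕ, σ)` carries the quasi-norm `(∫ |f| ^ α dσ) ^ (1 / α)`. -/
def embeddingLp (p : ℝ≥0∞) (α : ℝ) (σ : Measure ℕ) [IsFiniteMeasure σ] (z : SeqLp p) :
    Lp ℝ (ENNReal.ofReal α) σ :=
  (SeqLp.memLp α σ z).toLp (fun k : ℕ => z k)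

/-- The constant `c_α = √2 (∫_0^∞ x ^ (-α) sin x dx) ^ (-1/α) (E |ξ| ^ α) ^ (-1/α)` with `ξ` standard
normal. The first integral is improper (it does not converge absolutely for `α ≤ 1`). -/
def stableConst (α : ℝ) : ℝ :=
  √2 * (limUnder atTop fun R : ℝ => ∫ x in (0 : ℝ)..R, x ^ (-α) * Real.sin x) ^ (-1 / α)
    * (∫ x, |x| ^ α ∂(gaussianReal 0 1)) ^ (-1 / α)

/-- The random input: `V_j` are i.i.d. with the law `σ` (a probability measure on `ℕ`), `ζ_j` are
i.i.d. standard exponential, and the two sequences are independent of each other. -/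
structure IsRandomInput {Ω : Type*} [MeasurableSpace Ω] (Q : Measure Ω) (σ : Measure ℕ)
    (V : ℕ → Ω → ℕ) (ζ : ℕ → Ω → ℝ) : Prop where
  measurable_V : ∀ j, Measurable (V j)
  measurable_ζ : ∀ j, Measurable (ζ j)
  law_V : ∀ j, Q.map (V j) = σ
  law_ζ : ∀ j, Q.map (ζ j) = expMeasure 1
  iIndep_V : iIndepFun V Q
  iIndep_ζ : iIndepFun ζ Q
  indep : IndepFun (fun ω j => V j ω) (fun ω j => ζ j ω) Q

/-- The sequence `(c_α σ(ℕ)^(1/α) z_{V_j} Γ_j^(-1/α))_j` with `Γ_j = ζ_1 + ⋯ + ζ_j`, for one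
realization `V`, `ζ` of the random input. Indices start at `0`, so that `Γ_{j+1}` occurs at
position `j`. The function on `ℕ` represented by `u z` takes the value `z k` at `k`. -/
def randomSeq {p : ℝ≥0∞} (α : ℝ) (σ : Measure ℕ) (V : ℕ → ℕ) (ζ : ℕ → ℝ) (z : SeqLp p) (j : ℕ) : ℝ :=
  stableConst α * (σ.real Set.univ) ^ (1 / α)
    * (z (V j) * (∑ i ∈ Finset.range (j + 1), ζ i) ^ (-1 / α))

open Classical in
/-- The random operator `v : ℓ_p → ℓ_2` associated with `u`, for one realization `V`, `ζ` of the
random input. Almost surely `randomSeq` is square summable for all `z`; the value `0` is used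
otherwise. -/
def randomOp (p : ℝ≥0∞) (α : ℝ) (σ : Measure ℕ) (V : ℕ → ℕ) (ζ : ℕ → ℝ) (z : SeqLp p) : SeqLp 2 :=
  if h : Memℓp (fun j : ℕ => randomSeq α σ V ζ z j) 2 then ⟨_, h⟩ else 0

/-- The `n`-th entropy gap `G_n(u) = e_n(v) / (n ^ (-1/α + 1/2) e_n(u))` of the embedding
`u : ℓ_p → L_α(ℕ, σ)`, for one realization `V`, `ζ` of the random input. -/
def entropyGap (p : ℝ≥0∞) (α : ℝ) (σ : Measure ℕ) [IsFiniteMeasure σ] (V : ℕ → ℕ) (ζ : ℕ → ℝ)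
    (n : ℕ) : ℝ :=
  entropyNumber (randomOp p α σ V ζ) n /
    ((n : ℝ) ^ (-1 / α + 1 / 2) * entropyNumber (embeddingLp p α σ) n)

end

/-!
The law `σ` is chosen through its hazard rates. Put `a k = c d_{k+1}^{-α} / (k + 1)` with a small
constant `c`, let `T n = ∏_{i < n} (1 - a i)` and `σ {k} = T k * a k = T k - T (k + 1)`. Then `T n`
is the mass of `[n, ∞)`; the divergence of `∑ d_k^{-α} / k` says exactly that `T n → 0`, i.e. that
`σ` is a probability measure (`exists_measure_tailMass`). Both operators are essentially diagonal,
and what matters is the quotient `T n / (n σ {n}) ≈ d_n^α`.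

*Upper bound for the embedding.* `e_n(u) ≲ (σ {n} n^{1 - α/p})^{1/α}`
(`exists_entropyNumber_embeddingLp_le`). A sequence in the unit ball of `ℓ_p` is rounded towards
zero, coordinate by coordinate, to a grid of width `n^{-1/p} g((k + 1) / n)`, where `g` is a high
power below `1` and linear above `1`. Exponential weights show that only `2^{O(n)}` rounded sequences
occur (`card_lattice_points_le`). Below `n` the weights grow at most polynomially in `n / k`, by the
doubling property of `d`, which the fine grid compensates; above `n` they decay like `n / k`.

*Lower bound for the random operator.* A draw is at least `n` with probability `T n`, and `2n` atoms
beyond `n` carry at most half of that mass, so as long as fewer than `2n` values beyond `n` have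
appeared, each draw produces a new one with probability at least `T n / 2`. A supermartingale
argument and the Borel–Cantelli lemma give, almost surely for all large `n`, `2n` distinct values
among the first `m ≈ 12 n / T n` draws (`ae_eventually_le_card_tailValues`). By the strong law of large
numbers `Γ_m ≲ m`, so the image of the unit ball contains a `2n`-dimensional cube of side
`≈ n^{-1/p} m^{-1/α}`, and a Hamming-distance count (`le_entropyNumber_of_cube`) yields
`e_n(v) ≳ n^{1/2 - 1/p} (T n / n)^{1/α}`.

The quotient of the two bounds is `n^{-1/α + 1/2} (T n / (n σ {n}))^{1/α} ≈ n^{-1/α + 1/2} d_n`.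

The constant `c_α` must not vanish, so the improper integral in it has to converge to a positive
limit; integration by parts rewrites it as `α ∫ x^{-α-1} (1 - cos x) dx` (`stableConst_pos`).
-/

/-! ### The stable constant and the exponential distribution -/

lemma integrableOn_rpow_mul_one_sub_cos {α : ℝ} (hα0 : 0 < α) (hα2 : α < 2) :
    IntegrableOn (fun x : ℝ => x ^ (-α - 1) * (1 - Real.cos x)) (Set.Ioi 0) := by
  have hmeas : Measurable fun x : ℝ => x ^ (-α - 1) * (1 - Real.cos x) := by fun_prop
  rw [← Set.Ioc_union_Ioi_eq_Ioi (zero_le_one (α := ℝ))]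
  refine IntegrableOn.union ?_ ?_
  · have h : IntegrableOn (fun x : ℝ => x ^ (1 - α)) (Set.Ioc 0 1) :=
      (intervalIntegrable_iff_integrableOn_Ioc_of_le zero_le_one).1
        (intervalIntegral.intervalIntegrable_rpow' (by linarith))
    refine Integrable.mono' h hmeas.aestronglyMeasurable ?_
    refine (ae_restrict_iff' measurableSet_Ioc).2 (ae_of_all _ fun x hx => ?_)
    have hc := Real.one_sub_sq_div_two_le_cos (x := x)
    have hc1 := Real.cos_le_one x
    have hp := Real.rpow_pos_of_pos hx.1 (-α - 1)
    rw [Real.norm_eq_abs, abs_of_nonneg (mul_nonneg hp.le (by linarith))]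
    calc x ^ (-α - 1) * (1 - Real.cos x) ≤ x ^ (-α - 1) * x ^ (2 : ℝ) := by
          gcongr
          rw [Real.rpow_two]; nlinarith [sq_nonneg x]
      _ = x ^ (1 - α) := by rw [← Real.rpow_add hx.1]; ring_nf
  · have h : IntegrableOn (fun x : ℝ => 2 * x ^ (-α - 1)) (Set.Ioi 1) :=
      (integrableOn_Ioi_rpow_of_lt (by linarith) one_pos).const_mul 2
    refine Integrable.mono' h hmeas.aestronglyMeasurable ?_
    refine (ae_restrict_iff' measurableSet_Ioi).2 (ae_of_all _ fun x hx => ?_)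
    have hx0 : (0 : ℝ) < x := lt_trans one_pos hx
    have hc := Real.neg_one_le_cos x
    have hc1 := Real.cos_le_one x
    have hp := Real.rpow_pos_of_pos hx0 (-α - 1)
    rw [Real.norm_eq_abs, abs_of_nonneg (mul_nonneg hp.le (by linarith))]
    nlinarith

/-- Integration by parts turns the conditionally convergent integral into an absolutely convergent
one. -/
lemma integral_rpow_mul_sin {α : ℝ} (hα0 : 0 < α) (hα2 : α < 2) {R : ℝ} (hR : 0 < R) :
    ∫ x in (0 : ℝ)..R, x ^ (-α) * Real.sin x =
      R ^ (-α) * (1 - Real.cos R)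
        + α * ∫ x in (0 : ℝ)..R, x ^ (-α - 1) * (1 - Real.cos x) := by
  have hint2 : IntervalIntegrable (fun x : ℝ => x ^ (-α - 1) * (1 - Real.cos x)) volume 0 R :=
    (intervalIntegrable_iff_integrableOn_Ioc_of_le hR.le).2
      ((integrableOn_rpow_mul_one_sub_cos hα0 hα2).mono_set Set.Ioc_subset_Ioi_self)
  have hint1 : IntervalIntegrable (fun x : ℝ => x ^ (-α) * Real.sin x) volume 0 R := by
    have h : IntervalIntegrable (fun x : ℝ => x ^ (1 - α)) volume 0 R :=
      intervalIntegral.intervalIntegrable_rpow' (by linarith)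
    refine h.mono_fun' (by fun_prop) ?_
    rw [Set.uIoc_of_le hR.le]
    refine (ae_restrict_iff' measurableSet_Ioc).2 (ae_of_all _ fun x hx => ?_)
    have hp := Real.rpow_pos_of_pos hx.1 (-α)
    beta_reduce
    rw [norm_mul, Real.norm_eq_abs, Real.norm_eq_abs, abs_of_pos hp]
    calc x ^ (-α) * |Real.sin x| ≤ x ^ (-α) * |x| :=
          mul_le_mul_of_nonneg_left Real.abs_sin_le_abs hp.le
      _ = x ^ (-α) * x ^ (1 : ℝ) := by rw [abs_of_pos hx.1, Real.rpow_one]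
      _ = x ^ (1 - α) := by rw [← Real.rpow_add hx.1]; ring_nf
  have hcont : ContinuousOn (fun x : ℝ => x ^ (-α) * (1 - Real.cos x)) (Set.Icc 0 R) := by
    intro x hx
    rcases hx.1.eq_or_lt with rfl | hx0
    · have h0 : (0 : ℝ) ^ (-α) * (1 - Real.cos 0) = 0 := by simp
      unfold ContinuousWithinAt
      beta_reduce
      rw [h0]
      have hlim : Tendsto (fun x : ℝ => x ^ (2 - α)) (𝓝[Set.Icc 0 R] 0) (𝓝 0) := by
        have : ContinuousAt (fun x : ℝ => x ^ (2 - α)) 0 :=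
          Real.continuousAt_rpow_const _ _ (Or.inr (by linarith))
        have h2 := this.tendsto
        rw [Real.zero_rpow (by linarith)] at h2
        exact h2.mono_left nhdsWithin_le_nhds
      refine tendsto_of_tendsto_of_tendsto_of_le_of_le' tendsto_const_nhds hlim ?_ ?_
      · filter_upwards [self_mem_nhdsWithin] with y hy
        exact mul_nonneg (Real.rpow_nonneg hy.1 _) (by linarith [Real.cos_le_one y])
      · filter_upwards [self_mem_nhdsWithin] with y hy
        rcases hy.1.eq_or_lt with rfl | hy0
        · simp [Real.zero_rpow (by linarith : 2 - α ≠ 0)]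
        · calc y ^ (-α) * (1 - Real.cos y) ≤ y ^ (-α) * y ^ (2 : ℝ) := by
                gcongr
                rw [Real.rpow_two]
                nlinarith [sq_nonneg y, Real.one_sub_sq_div_two_le_cos (x := y)]
            _ = y ^ (2 - α) := by rw [← Real.rpow_add hy0]; ring_nf
    · exact ((Real.continuousAt_rpow_const _ _ (Or.inl hx0.ne')).mul
        (by fun_prop)).continuousWithinAt
  have hderiv : ∀ x ∈ Set.Ioo 0 R, HasDerivAt (fun x : ℝ => x ^ (-α) * (1 - Real.cos x))
      (x ^ (-α) * Real.sin x - α * (x ^ (-α - 1) * (1 - Real.cos x))) x := by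
    intro x hx
    have h1 := Real.hasDerivAt_rpow_const (x := x) (p := -α) (Or.inl hx.1.ne')
    have h2 := ((Real.hasDerivAt_cos x).const_sub 1)
    exact (h1.mul h2).congr_deriv (by ring)
  have := intervalIntegral.integral_eq_sub_of_hasDerivAt_of_le hR.le hcont hderiv
    (hint1.sub (hint2.const_mul α))
  rw [intervalIntegral.integral_sub hint1 (hint2.const_mul α),
    intervalIntegral.integral_const_mul] at this
  simp only [Real.cos_zero, sub_self, mul_zero, sub_zero] at this
  linarith

lemma tendsto_integral_rpow_mul_sin {α : ℝ} (hα0 : 0 < α) (hα2 : α < 2) :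
    Tendsto (fun R : ℝ => ∫ x in (0 : ℝ)..R, x ^ (-α) * Real.sin x) atTop
      (𝓝 (α * ∫ x in Set.Ioi (0 : ℝ), x ^ (-α - 1) * (1 - Real.cos x))) := by
  have h1 : Tendsto (fun R : ℝ => R ^ (-α) * (1 - Real.cos R)) atTop (𝓝 0) := by
    refine (tendsto_rpow_neg_atTop hα0).zero_mul_isBoundedUnder_le ?_
    refine isBoundedUnder_of ⟨2, fun x => ?_⟩
    simp only [Function.comp, Real.norm_eq_abs]
    rw [abs_le]
    constructor <;> linarith [Real.cos_le_one x, Real.neg_one_le_cos x]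
  have h2 := intervalIntegral_tendsto_integral_Ioi 0
    (integrableOn_rpow_mul_one_sub_cos hα0 hα2) tendsto_id
  have h3 := h1.add (h2.const_mul α)
  rw [zero_add] at h3
  refine h3.congr' ?_
  filter_upwards [eventually_gt_atTop 0] with R hR
  exact (integral_rpow_mul_sin hα0 hα2 hR).symm

lemma stableConst_pos {α : ℝ} (hα0 : 0 < α) (hα2 : α < 2) : 0 < stableConst α := by
  have hpos : 0 < ∫ x in Set.Ioi (0 : ℝ), x ^ (-α - 1) * (1 - Real.cos x) := by
    rw [setIntegral_pos_iff_support_of_nonneg_ae ?_ (integrableOn_rpow_mul_one_sub_cos hα0 hα2)]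
    · refine lt_of_lt_of_le ?_ (measure_mono (s := Set.Ioo 0 1) ?_)
      · simp
      · intro x hx
        refine ⟨(mul_pos (Real.rpow_pos_of_pos hx.1 _) ?_).ne', hx.1⟩
        have := Real.cos_lt_cos_of_nonneg_of_le_pi le_rfl
          (hx.2.le.trans (by linarith [Real.pi_gt_three])) hx.1
        rw [Real.cos_zero] at this
        linarith
    · refine (ae_restrict_iff' measurableSet_Ioi).2 (ae_of_all _ fun x hx => ?_)
      exact mul_nonneg (Real.rpow_nonneg (le_of_lt hx) _) (by linarith [Real.cos_le_one x])
  have hG : 0 < ∫ x, |x| ^ α ∂(gaussianReal 0 1) := by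
    have hint : Integrable (fun x : ℝ => |x| ^ α) (gaussianReal 0 1) := by
      have h := (memLp_id_gaussianReal' (μ := 0) (v := 1) (ENNReal.ofReal α)
        ENNReal.ofReal_ne_top).integrable_norm_rpow (by simpa using hα0) ENNReal.ofReal_ne_top
      simpa [ENNReal.toReal_ofReal hα0.le] using h
    rw [integral_pos_iff_support_of_nonneg (fun x => Real.rpow_nonneg (abs_nonneg x) _) hint]
    have hsupp : Function.support (fun x : ℝ => |x| ^ α) = {0}ᶜ := by
      ext x
      simp [Function.mem_support, Real.rpow_eq_zero (abs_nonneg x) hα0.ne']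
    have := nullSingletonClass_gaussianReal (μ := 0) (v := 1) one_ne_zero
    rw [hsupp, prob_compl_eq_one_sub (measurableSet_singleton 0), measure_singleton]
    simp
  unfold stableConst
  rw [(tendsto_integral_rpow_mul_sin hα0 hα2).limUnder_eq]
  have := Real.rpow_pos_of_pos (mul_pos hα0 hpos) (-1 / α)
  have := Real.rpow_pos_of_pos hG (-1 / α)
  positivity

lemma ae_pos_expMeasure : ∀ᵐ x ∂(expMeasure 1), 0 < x := by
  unfold expMeasure gammaMeasure
  rw [ae_withDensity_iff (by unfold gammaPDF; exact (measurable_gammaPDFReal 1 1).ennreal_ofReal)]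
  filter_upwards [compl_mem_ae_iff.2 (measure_singleton (0 : ℝ))] with x hx h
  by_contra hneg
  exact h (gammaPDF_of_neg (lt_of_le_of_ne (not_lt.1 hneg) hx))

lemma integrable_id_expMeasure : Integrable id (expMeasure 1) := by
  unfold expMeasure gammaMeasure
  rw [integrable_withDensity_iff
      (by unfold gammaPDF; exact (measurable_gammaPDFReal 1 1).ennreal_ofReal)
    (ae_of_all _ fun x => by simp [gammaPDF])]
  have h := (integrable_indicator_iff measurableSet_Ioi).2
    (Real.GammaIntegral_convergent (s := 2) two_pos)
  refine h.congr ?_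
  refine ae_of_all _ fun x => ?_
  rcases lt_or_ge 0 x with hx | hx
  · simp only [Set.indicator_of_mem (Set.mem_Ioi.2 hx)]
    rw [gammaPDF, ENNReal.toReal_ofReal (gammaPDFReal_nonneg one_pos one_pos x)]
    norm_num [gammaPDFReal, hx.le]
    ring
  · rw [Set.indicator_of_notMem (by simpa using hx)]
    rcases hx.eq_or_lt with rfl | hx
    · simp
    · simp [gammaPDF_of_neg hx]

/-! ### Entropy numbers from below: discrete cubes -/

open scoped symmDiff

/-- A `2n`-element set has at most `2 ^ n` subsets of size at most `n / 8`. -/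
lemma card_powerset_filter_card_le {ι : Type*} [DecidableEq ι] (A : Finset ι) {n h : ℕ}
    (hA : A.card = 2 * n) (hh : 8 * h ≤ n) :
    (A.powerset.filter fun S => S.card ≤ h).card ≤ 2 ^ n := by
  set M := (A.powerset.filter fun S => S.card ≤ h).card with hM
  -- Weight each subset `S` by `(1/4) ^ #S`; the total weight of all subsets is `(5/4) ^ (2n)`.
  have h1 : (M : ℝ) * (1 / 4) ^ h ≤ (5 / 4) ^ (2 * n) := by
    calc (M : ℝ) * (1 / 4) ^ h
        = ∑ S ∈ A.powerset.filter fun S => S.card ≤ h, (1 / 4 : ℝ) ^ h := by simp [hM]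
      _ ≤ ∑ S ∈ A.powerset.filter fun S => S.card ≤ h, (1 / 4 : ℝ) ^ S.card := by
          refine Finset.sum_le_sum fun S hS => ?_
          exact pow_le_pow_of_le_one (by norm_num) (by norm_num) (Finset.mem_filter.1 hS).2
      _ ≤ ∑ S ∈ A.powerset, (1 / 4 : ℝ) ^ S.card :=
          Finset.sum_le_sum_of_subset_of_nonneg (Finset.filter_subset _ _)
            fun _ _ _ => by positivity
      _ = (5 / 4) ^ (2 * n) := by
          have := Finset.sum_pow_mul_eq_add_pow (1 / 4 : ℝ) 1 A
          rw [hA] at this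
          simp only [one_pow, mul_one] at this
          rw [this]; norm_num
  have h2 : (M : ℝ) ≤ 4 ^ h * (5 / 4) ^ (2 * n) := by
    calc (M : ℝ) = 4 ^ h * (M * (1 / 4) ^ h) := by
          rw [one_div, inv_pow]; field_simp
      _ ≤ _ := by gcongr
  have h3 : (M : ℝ) ^ 4 ≤ ((2 : ℝ) ^ n) ^ 4 := by
    calc (M : ℝ) ^ 4 ≤ (4 ^ h * (5 / 4) ^ (2 * n)) ^ 4 := by gcongr
      _ = 2 ^ (8 * h) * ((5 / 4) ^ 8) ^ n := by
          rw [show (4 : ℝ) ^ h = 2 ^ (2 * h) by rw [pow_mul]; norm_num, mul_pow, ← pow_mul,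
            ← pow_mul, ← pow_mul]
          congr 2 <;> ring
      _ ≤ 2 ^ n * ((5 / 4) ^ 8) ^ n := by gcongr; norm_num
      _ = (2 * (5 / 4) ^ 8) ^ n := by rw [mul_pow]
      _ ≤ 16 ^ n := by gcongr; norm_num
      _ = ((2 : ℝ) ^ n) ^ 4 := by rw [← pow_mul, mul_comm, pow_mul]; norm_num
  have h4 := le_of_pow_le_pow_left₀ (by norm_num) (by positivity) h3
  exact_mod_cast h4

/-- Colour the subsets of a `2n`-element set with `2 ^ (n - 1)` colours: two subsets of the same
colour differ in at least `n / 8` places. -/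
lemma exists_card_symmDiff_ge {ι : Type*} [DecidableEq ι] (A : Finset ι) {n : ℕ} (hn : 1 ≤ n)
    (hA : A.card = 2 * n) (f : Finset ι → Fin (2 ^ (n - 1))) :
    ∃ S ⊆ A, ∃ S' ⊆ A, f S = f S' ∧ n ≤ 8 * (S ∆ S').card := by
  obtain ⟨c, -, hc⟩ := Finset.exists_lt_card_fiber_of_mul_lt_card_of_maps_to
    (s := A.powerset) (t := Finset.univ) (f := f) (n := 2 ^ n) (fun _ _ => Finset.mem_univ _) (by
      rw [Finset.card_univ, Fintype.card_fin, Finset.card_powerset, hA, ← pow_add]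
      exact Nat.pow_lt_pow_right (by norm_num) (by omega))
  obtain ⟨S, hS⟩ := Finset.card_pos.1 (lt_of_le_of_lt (Nat.zero_le _) hc)
  rw [Finset.mem_filter, Finset.mem_powerset] at hS
  by_contra! hcon
  have hball := card_powerset_filter_card_le A hA (h := n / 8) (by omega)
  refine absurd (hc.trans_le (le_trans ?_ hball)) (lt_irrefl _)
  refine Finset.card_le_card_of_injOn (fun S' => S ∆ S') ?_
    (fun _ _ _ _ h => symmDiff_right_injective S h)
  intro S' hS'
  rw [Finset.mem_coe, Finset.mem_filter, Finset.mem_powerset] at hS'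
  rw [Finset.mem_coe, Finset.mem_filter, Finset.mem_powerset]
  refine ⟨(Finset.symmDiff_subset_union).trans (Finset.union_subset hS.1 hS'.1), ?_⟩
  have := hcon S hS.1 S' hS'.1 (hS.2.trans hS'.2.symm)
  beta_reduce
  omega

lemma entropyNumber_nonneg {E F : Type*} [Norm E] [Norm F] [Sub F] (T : E → F) (n : ℕ) :
    0 ≤ entropyNumber T n :=
  Real.sInf_nonneg fun _ h => h.1.le

/-- If the image of the unit ball contains a copy of a `2n`-dimensional discrete cube with side
lengths at least `b`, then the `n`-th entropy number is at least of order `b √n`. -/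
lemma le_entropyNumber_of_cube {E : Type*} [Norm E] {T : E → SeqLp 2}
    (hT : ∃ C, ∀ z, ‖z‖ ≤ 1 → ‖T z‖ ≤ C) {n : ℕ} (hn : 1 ≤ n) {A : Finset ℕ}
    (hA : A.card = 2 * n) (z : Finset ℕ → E) (hz : ∀ S ⊆ A, ‖z S‖ ≤ 1) {b : ℝ} (hb : 0 ≤ b)
    (hsep : ∀ S ⊆ A, ∀ S' ⊆ A, ∀ j ∈ S ∆ S', b ≤ |T (z S) j - T (z S') j|) :
    b * √n / 6 ≤ entropyNumber T n := by
  refine le_csInf ?_ ?_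
  · obtain ⟨C, hC⟩ := hT
    refine ⟨max C 1, lt_max_of_lt_right one_pos, fun _ => 0, fun x hx => ⟨⟨0, by positivity⟩, ?_⟩⟩
    rw [sub_zero]
    exact (hC x hx).trans (le_max_left _ _)
  rintro ε ⟨hε, y, hy⟩
  have hex : ∀ S : Finset ℕ, ∃ i, S ⊆ A → ‖T (z S) - y i‖ ≤ ε := by
    intro S
    by_cases hS : S ⊆ A
    · obtain ⟨i, hi⟩ := hy (z S) (hz S hS)
      exact ⟨i, fun _ => hi⟩
    · exact ⟨⟨0, by positivity⟩, fun h => absurd h hS⟩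
  choose f hf using hex
  obtain ⟨S, hS, S', hS', hff, hcard⟩ := exists_card_symmDiff_ge A hn hA f
  have h1 : ‖T (z S) - T (z S')‖ ≤ 2 * ε := by
    have e1 := hf S hS
    have e2 := hf S' hS'
    rw [← hff] at e2
    calc ‖T (z S) - T (z S')‖ = ‖(T (z S) - y (f S)) - (T (z S') - y (f S))‖ := by
          congr 1; abel
      _ ≤ _ := norm_sub_le _ _
      _ ≤ 2 * ε := by linarith
  have h2 := lp.sum_rpow_le_norm_rpow (p := 2) (by norm_num) (T (z S) - T (z S')) (S ∆ S')
  norm_num at h2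
  have h3 : (n / 8 : ℝ) * b ^ 2 ≤ (2 * ε) ^ 2 := by
    calc (n / 8 : ℝ) * b ^ 2 ≤ (S ∆ S').card * b ^ 2 := by
          have : (n : ℝ) ≤ 8 * (S ∆ S').card := by exact_mod_cast hcard
          gcongr; linarith
      _ = ∑ j ∈ S ∆ S', b ^ 2 := by simp
      _ ≤ ∑ j ∈ S ∆ S', (T (z S) j - T (z S') j) ^ 2 := by
          refine Finset.sum_le_sum fun j hj => ?_
          rw [← sq_abs (T (z S) j - T (z S') j)]
          gcongr
          exact hsep S hS S' hS' j hj
      _ ≤ ‖T (z S) - T (z S')‖ ^ 2 := h2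
      _ ≤ (2 * ε) ^ 2 := by gcongr
  refine le_of_pow_le_pow_left₀ two_ne_zero hε.le ?_
  rw [div_pow, mul_pow, Real.sq_sqrt (Nat.cast_nonneg n)]
  nlinarith [sq_nonneg b, mul_nonneg (Nat.cast_nonneg (α := ℝ) n) (sq_nonneg b)]

/-! ### Counting lattice points in weighted balls -/

lemma exists_int_mul_truncate (x : ℝ) {δ : ℝ} (hδ : 0 < δ) :
    ∃ m : ℤ, |(m : ℝ)| * δ ≤ |x| ∧ |x - m * δ| ≤ δ ∧ |x - m * δ| ≤ |x| := by
  have key : ∀ y : ℝ, 0 ≤ y →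
      ∃ m : ℤ, |(m : ℝ)| * δ ≤ |y| ∧ |y - m * δ| ≤ δ ∧ |y - m * δ| ≤ |y| := by
    intro y hy
    have h0 : (0 : ℝ) ≤ ⌊y / δ⌋ := by exact_mod_cast Int.floor_nonneg.2 (by positivity)
    have h1 : (⌊y / δ⌋ : ℝ) * δ ≤ y := (le_div_iff₀ hδ).1 (Int.floor_le _)
    have h2 : y ≤ (⌊y / δ⌋ + 1 : ℝ) * δ := (div_le_iff₀ hδ).1 (Int.lt_floor_add_one _).le
    refine ⟨⌊y / δ⌋, ?_⟩
    rw [abs_of_nonneg h0, abs_of_nonneg hy, abs_of_nonneg (by linarith : 0 ≤ y - ⌊y / δ⌋ * δ)]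
    refine ⟨h1, by linarith, ?_⟩
    have := mul_nonneg h0 hδ.le
    linarith
  rcases le_total 0 x with hx | hx
  · exact key x hx
  · obtain ⟨m, h1, h2, h3⟩ := key (-x) (by linarith)
    have e : x - ((-m : ℤ) : ℝ) * δ = -(-x - m * δ) := by push_cast; ring
    refine ⟨-m, ?_, ?_, ?_⟩
    · simpa using h1
    · rw [e, abs_neg]; exact h2
    · rw [e, abs_neg, ← abs_neg x]; exact h3

lemma sum_exp_neg_mul_abs_le {G : ℝ} (hG : 0 < G) (t : Finset ℤ) :
    ∑ j ∈ t, Real.exp (-(G * |(j : ℝ)|)) ≤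
      1 + 2 * (Real.exp (-G) / (1 - Real.exp (-G))) := by
  set q := Real.exp (-G) with hq
  have hq0 : 0 < q := Real.exp_pos _
  have hq1 : q < 1 := Real.exp_lt_one_iff.2 (by linarith)
  have hgeo := hasSum_geometric_of_lt_one hq0.le hq1
  have hpow : ∀ k : ℕ, Real.exp (-(G * (k : ℝ))) = q ^ k := fun k => by
    rw [hq, ← Real.exp_nat_mul]; ring_nf
  have h1 : HasSum (fun k : ℕ => Real.exp (-(G * |(((k : ℕ) : ℤ) : ℝ)|))) (1 - q)⁻¹ := by
    have e : (fun k : ℕ => Real.exp (-(G * |(((k : ℕ) : ℤ) : ℝ)|))) = fun k => q ^ k := by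
      funext k
      rw [← hpow]; simp
    rw [e]; exact hgeo
  have h2 : HasSum (fun k : ℕ => Real.exp (-(G * |((-((k : ℤ) + 1) : ℤ) : ℝ)|)))
      (q * (1 - q)⁻¹) := by
    have e : (fun k : ℕ => Real.exp (-(G * |((-((k : ℤ) + 1) : ℤ) : ℝ)|)))
        = fun k => q * q ^ k := by
      funext k
      rw [← pow_succ', ← hpow]
      push_cast
      rw [abs_neg, abs_of_nonneg (by positivity)]
    rw [e]; exact hgeo.mul_left q
  have h3 := HasSum.of_nat_of_neg_add_one
    (f := fun j : ℤ => Real.exp (-(G * |(j : ℝ)|))) h1 h2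
  refine (sum_le_hasSum t (fun _ _ => (Real.exp_pos _).le) h3).trans_eq ?_
  have : 1 - q ≠ 0 := by linarith
  field_simp
  ring

/-- Exponential weights bound the number of lattice points in a weighted `ℓ₁`-ball. -/
lemma card_le_exp_mul_prod {ι : Type*} [Fintype ι] [DecidableEq ι] {G : ι → ℝ}
    (hG : ∀ k, 0 < G k) {X : ℝ} (t : ι → Finset ℤ) (M : Finset (ι → ℤ))
    (ht : M ⊆ Fintype.piFinset t) (hM : ∀ m ∈ M, ∑ k, G k * |(m k : ℝ)| ≤ X) :
    (M.card : ℝ) ≤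
      Real.exp X * ∏ k, (1 + 2 * (Real.exp (-G k) / (1 - Real.exp (-G k)))) := by
  calc (M.card : ℝ) = ∑ m ∈ M, (1 : ℝ) := by simp
    _ ≤ ∑ m ∈ M, Real.exp X * ∏ k, Real.exp (-(G k * |(m k : ℝ)|)) := by
        refine Finset.sum_le_sum fun m hm => ?_
        rw [← Real.exp_sum, ← Real.exp_add, Finset.sum_neg_distrib]
        exact Real.one_le_exp (by linarith [hM m hm])
    _ ≤ ∑ m ∈ Fintype.piFinset t, Real.exp X * ∏ k, Real.exp (-(G k * |(m k : ℝ)|)) :=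
        Finset.sum_le_sum_of_subset_of_nonneg ht fun _ _ _ =>
          mul_nonneg (Real.exp_pos _).le (Finset.prod_nonneg fun _ _ => (Real.exp_pos _).le)
    _ = Real.exp X * ∏ k, ∑ j ∈ t k, Real.exp (-(G k * |(j : ℝ)|)) := by
        rw [← Finset.mul_sum, Finset.prod_univ_sum]
    _ ≤ _ := by
        refine mul_le_mul_of_nonneg_left ?_ (Real.exp_pos _).le
        exact Finset.prod_le_prod
          (fun _ _ => Finset.sum_nonneg fun _ _ => (Real.exp_pos _).le)
          (fun k _ => sum_exp_neg_mul_abs_le (hG k) (t k))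

lemma exp_neg_div_le_inv {G H : ℝ} (hG : 0 < G) (hH : 0 < H) (hGH : H ≤ G) :
    Real.exp (-G) / (1 - Real.exp (-G)) ≤ H⁻¹ := by
  have h1 : Real.exp (-G) < 1 := Real.exp_lt_one_iff.2 (by linarith)
  have h2 : Real.exp (-G) * Real.exp G = 1 := by rw [← Real.exp_add]; simp
  have h3 := Real.add_one_le_exp G
  have h4 := Real.exp_pos (-G)
  rw [inv_eq_one_div, div_le_div_iff₀ (by linarith) hH]
  nlinarith [mul_le_mul_of_nonneg_left h3 h4.le, mul_le_mul_of_nonneg_left hGH h4.le]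

lemma exp_neg_div_le_two_mul_inv_sq {G H : ℝ} (hH : 0 < H) (hGH : H ≤ G) :
    Real.exp (-G) / (1 - Real.exp (-G)) ≤ 2 * (H ^ 2)⁻¹ := by
  have hG : 0 < G := hH.trans_le hGH
  have h1 : Real.exp (-G) < 1 := Real.exp_lt_one_iff.2 (by linarith)
  have h2 : Real.exp (-G) * Real.exp G = 1 := by rw [← Real.exp_add]; simp
  have h3 := Real.quadratic_le_exp_of_nonneg hG.le
  have h4 := Real.exp_pos (-G)
  have h5 : H ^ 2 ≤ G ^ 2 := by gcongr
  rw [← div_eq_mul_inv, div_le_div_iff₀ (by linarith) (by positivity)]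
  nlinarith [mul_le_mul_of_nonneg_left h3 h4.le, mul_le_mul_of_nonneg_left h5 h4.le,
    mul_pos h4 hG]

lemma sum_Ico_sq_div_le {n K : ℕ} (hn : 1 ≤ n) (hK : n ≤ K) :
    ∑ k ∈ Finset.Ico n K, ((((k : ℝ) + 1) / n) ^ 2)⁻¹ ≤ (n : ℝ) := by
  have h := sum_Ioc_inv_sq_le_sub (α := ℝ) (by omega : n ≠ 0) hK
  have e : ∑ k ∈ Finset.Ico n K, ((((k : ℝ) + 1) / n) ^ 2)⁻¹
      = (n : ℝ) ^ 2 * ∑ i ∈ Finset.Ioc n K, ((i : ℝ) ^ 2)⁻¹ := by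
    rw [Finset.mul_sum, ← Finset.Ico_add_one_add_one_eq_Ioc, ← Finset.sum_Ico_add' _ n K 1]
    refine Finset.sum_congr rfl fun k _ => ?_
    push_cast
    rw [div_pow, inv_div, div_eq_mul_inv]
  have hn' : (0 : ℝ) < n := by exact_mod_cast hn
  have hK' : (0 : ℝ) ≤ (K : ℝ)⁻¹ := by positivity
  rw [e]
  calc (n : ℝ) ^ 2 * _ ≤ (n : ℝ) ^ 2 * (n : ℝ)⁻¹ := by gcongr; linarith
    _ = (n : ℝ) := by field_simp

/-- For weights growing like a power of `(k + 1) / n` below `n` and at least linearly above `n`,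
the weighted `ℓ₁`-ball of radius `n` contains only `2 ^ O(n)` lattice points. -/
lemma card_lattice_points_le {n K B : ℕ} (hn : 1 ≤ n) (hK : n ≤ K) {G : Fin K → ℝ}
    (hG1 : ∀ k : Fin K, (k : ℕ) < n → (((k : ℕ) + 1 : ℝ) / n) ^ B ≤ G k)
    (hG2 : ∀ k : Fin K, n ≤ (k : ℕ) → ((k : ℕ) + 1 : ℝ) / n ≤ G k)
    (t : Fin K → Finset ℤ) (M : Finset (Fin K → ℤ))
    (ht : M ⊆ Fintype.piFinset t) (hM : ∀ m ∈ M, ∑ k, G k * |(m k : ℝ)| ≤ n) :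
    M.card ≤ 2 ^ (2 * (B + 7) * n) := by
  have hn' : (0 : ℝ) < n := by exact_mod_cast hn
  have hG : ∀ k, 0 < G k := fun k => by
    rcases lt_or_ge (k : ℕ) n with h | h
    · exact lt_of_lt_of_le (by positivity) (hG1 k h)
    · exact lt_of_lt_of_le (by positivity) (hG2 k h)
  have h1 := card_le_exp_mul_prod hG t M ht hM
  let b : ℕ → ℝ := fun k => if k < n then 3 * ((n : ℝ) / (k + 1)) ^ B
    else Real.exp (4 * ((((k : ℝ) + 1) / n) ^ 2)⁻¹)
  have h2 : ∏ k, (1 + 2 * (Real.exp (-G k) / (1 - Real.exp (-G k)))) ≤ ∏ k : Fin K, b k := by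
    refine Finset.prod_le_prod (fun k _ => ?_) fun k _ => ?_
    · have : Real.exp (-G k) < 1 := Real.exp_lt_one_iff.2 (by linarith [hG k])
      have := div_nonneg (Real.exp_pos (-G k)).le (by linarith : 0 ≤ 1 - Real.exp (-G k))
      positivity
    · simp only [b]
      split_ifs with h
      · have e := exp_neg_div_le_inv (hG k) (by positivity) (hG1 k h)
        rw [← inv_pow, inv_div] at e
        have : (1 : ℝ) ≤ ((n : ℝ) / ((k : ℕ) + 1)) ^ B := by
          apply one_le_pow₀
          rw [one_le_div (by positivity)]
          exact_mod_cast h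
        linarith
      · have e := exp_neg_div_le_two_mul_inv_sq (by positivity) (hG2 k (not_lt.1 h))
        refine le_trans ?_ (Real.add_one_le_exp _)
        linarith
  have h3 : ∏ k : Fin K, b k ≤ Real.exp ((B + 6) * n) := by
    rw [Fin.prod_univ_eq_prod_range b K, ← Finset.prod_range_mul_prod_Ico b hK]
    have e1 : ∏ k ∈ Finset.range n, b k ≤ Real.exp ((B + 2) * n) := by
      calc ∏ k ∈ Finset.range n, b k
          = ∏ k ∈ Finset.range n, 3 * ((n : ℝ) / (k + 1)) ^ B :=
            Finset.prod_congr rfl fun k hk => by simp [b, Finset.mem_range.1 hk]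
        _ = 3 ^ n * ((n : ℝ) ^ n / n.factorial) ^ B := by
            rw [Finset.prod_mul_distrib, Finset.prod_const, Finset.card_range, Finset.prod_pow,
              Finset.prod_div_distrib, Finset.prod_const, Finset.card_range,
              ← Finset.prod_range_add_one_eq_factorial]
            push_cast
            rfl
        _ ≤ Real.exp 2 ^ n * Real.exp n ^ B := by
            gcongr
            · have := Real.add_one_le_exp 2; linarith
            · exact Real.pow_div_factorial_le_exp _ hn'.le n
        _ = Real.exp ((B + 2) * n) := by
            rw [← Real.exp_nat_mul, ← Real.exp_nat_mul, ← Real.exp_add]; ring_nf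
    have e2 : ∏ k ∈ Finset.Ico n K, b k ≤ Real.exp (4 * n) := by
      calc ∏ k ∈ Finset.Ico n K, b k
          = ∏ k ∈ Finset.Ico n K, Real.exp (4 * ((((k : ℝ) + 1) / n) ^ 2)⁻¹) :=
            Finset.prod_congr rfl fun k hk => by simp [b, (Finset.mem_Ico.1 hk).1.not_gt]
        _ = Real.exp (4 * ∑ k ∈ Finset.Ico n K, ((((k : ℝ) + 1) / n) ^ 2)⁻¹) := by
            rw [← Real.exp_sum, Finset.mul_sum]
        _ ≤ _ := by
            gcongr
            exact sum_Ico_sq_div_le hn hK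
    calc _ ≤ Real.exp ((B + 2) * n) * Real.exp (4 * n) := by
          refine mul_le_mul e1 e2 (Finset.prod_nonneg fun k _ => ?_) (Real.exp_pos _).le
          simp only [b]; split_ifs <;> positivity
      _ = _ := by rw [← Real.exp_add]; ring_nf
  have h4 : (M.card : ℝ) ≤ (2 : ℝ) ^ (2 * (B + 7) * n) := by
    calc (M.card : ℝ) ≤ Real.exp n * Real.exp ((B + 6) * n) := by
          refine h1.trans ?_
          gcongr
          exact h2.trans h3
      _ = Real.exp 1 ^ ((B + 7) * n) := by
          rw [← Real.exp_add, ← Real.exp_nat_mul]; push_cast; ring_nf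
      _ ≤ ((2 : ℝ) ^ 2) ^ ((B + 7) * n) := by
          gcongr
          have := Real.exp_one_lt_d9; linarith
      _ = _ := by rw [← pow_mul]; ring_nf
  exact_mod_cast h4

/-! ### Quantization errors -/

lemma rpow_neg_one_sub_le {θ x : ℝ} (hθ : 0 ≤ θ) (hx : 0 < x) :
    θ * (x + 1) ^ (-1 - θ) ≤ x ^ (-θ) - (x + 1) ^ (-θ) := by
  have hx1 : 0 < x + 1 := by linarith
  have h1 : 1 + θ * (x + 1)⁻¹ ≤ ((x + 1) / x) ^ θ := by
    rw [Real.rpow_def_of_pos (by positivity)]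
    have h2 := Real.one_sub_inv_le_log_of_pos (x := (x + 1) / x) (by positivity)
    have h3 : 1 - ((x + 1) / x)⁻¹ = (x + 1)⁻¹ := by field_simp; ring
    rw [h3] at h2
    have h4 := Real.add_one_le_exp (Real.log ((x + 1) / x) * θ)
    nlinarith [mul_le_mul_of_nonneg_right h2 hθ]
  have h5 : x ^ (-θ) = (x + 1) ^ (-θ) * ((x + 1) / x) ^ θ := by
    rw [Real.div_rpow hx1.le hx.le, Real.rpow_neg hx.le, Real.rpow_neg hx1.le]
    have := (Real.rpow_pos_of_pos hx1 θ).ne'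
    field_simp
  have h6 : (x + 1) ^ (-1 - θ) = (x + 1) ^ (-θ) * (x + 1)⁻¹ := by
    rw [← Real.rpow_neg_one (x + 1), ← Real.rpow_add hx1]; ring_nf
  rw [h5, h6]
  nlinarith [mul_le_mul_of_nonneg_left h1 (Real.rpow_nonneg hx1.le (-θ))]

lemma sum_Ico_rpow_le {θ : ℝ} (hθ : 0 < θ) {n K : ℕ} (hn : 1 ≤ n) (hK : n ≤ K) :
    ∑ k ∈ Finset.Ico n K, (((k : ℝ) + 1) / n) ^ (-1 - θ) ≤ (n : ℝ) / θ := by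
  have hn' : (0 : ℝ) < n := by exact_mod_cast hn
  have h1 : ∑ k ∈ Finset.Ico n K, ((k : ℝ) + 1) ^ (-1 - θ) ≤ (n : ℝ) ^ (-θ) / θ := by
    have : ∑ k ∈ Finset.Ico n K, ((k : ℝ) + 1) ^ (-1 - θ)
        ≤ ((n : ℝ) ^ (-θ) - (K : ℝ) ^ (-θ)) / θ := by
      induction K, hK using Nat.le_induction with
      | base => simp
      | succ K hK ih =>
        rw [Finset.sum_Ico_succ_top hK]
        have hKpos : (0 : ℝ) < K := by exact_mod_cast (by omega : 0 < K)
        have h := rpow_neg_one_sub_le hθ.le hKpos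
        rw [le_div_iff₀ hθ] at ih ⊢
        push_cast
        linarith
    refine this.trans ?_
    have := Real.rpow_nonneg (Nat.cast_nonneg (α := ℝ) K) (-θ)
    gcongr; linarith
  have h2 : ∀ k ∈ Finset.Ico n K, (((k : ℝ) + 1) / n) ^ (-1 - θ)
      = (n : ℝ) ^ (1 + θ) * ((k : ℝ) + 1) ^ (-1 - θ) := fun k _ => by
    rw [Real.div_rpow (by positivity) hn'.le, div_eq_mul_inv, ← Real.rpow_neg hn'.le, mul_comm]
    ring_nf
  rw [Finset.sum_congr rfl h2, ← Finset.mul_sum]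
  calc _ ≤ (n : ℝ) ^ (1 + θ) * ((n : ℝ) ^ (-θ) / θ) := by gcongr
    _ = (n : ℝ) ^ (1 + θ + -θ) / θ := by rw [Real.rpow_add hn' (1 + θ)]; ring
    _ = (n : ℝ) / θ := by norm_num

/-- The quantization error in a coordinate beyond `n`. For `P ≤ α` the error is controlled by
`|z| ^ P` alone; for `P > α` the coordinate is compared with the threshold `(r n) ^ (-1 / P)`. -/
lemma mul_rpow_le_of_one_le {α P : ℝ} (hα0 : 0 < α) (hα2 : α < 2) (hP : 1 ≤ P) {n r w s e z : ℝ}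
    (hn : 0 < n) (hr : 1 ≤ r) (hw : 0 ≤ w) (hs : s ≤ w * r⁻¹) (he0 : 0 ≤ e)
    (hez : e ≤ z) (hen : e ≤ n ^ (-1 / P) * r) :
    s * e ^ α ≤ w * n ^ (1 - α / P) * z ^ P + w * n ^ (-α / P) * r ^ (-1 - α / P) := by
  have hr0 : 0 < r := by linarith
  have hP0 : 0 < P := by linarith
  have hz0 : 0 ≤ z := he0.trans hez
  rcases he0.eq_or_lt with rfl | he
  · rw [Real.zero_rpow hα0.ne', mul_zero]; positivity
  have hz : 0 < z := he.trans_le hez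
  rcases le_or_gt P α with h | h
  · have h1 : e ^ α ≤ n ^ (1 - α / P) * r * z ^ P := by
      calc e ^ α = e ^ (α - P) * e ^ P := by rw [← Real.rpow_add he]; ring_nf
        _ ≤ (n ^ (-1 / P) * r) ^ (α - P) * z ^ P := by
            gcongr
        _ = n ^ (1 - α / P) * r ^ (α - P) * z ^ P := by
            rw [Real.mul_rpow (by positivity) hr0.le, ← Real.rpow_mul hn.le]
            congr 3
            field_simp
            ring
        _ ≤ n ^ (1 - α / P) * r ^ (1 : ℝ) * z ^ P := by
            gcongr
            linarith
        _ = _ := by rw [Real.rpow_one]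
    calc s * e ^ α ≤ w * r⁻¹ * (n ^ (1 - α / P) * r * z ^ P) := by gcongr
      _ = w * n ^ (1 - α / P) * z ^ P := by field_simp
      _ ≤ _ := le_add_of_nonneg_right (by positivity)
  · set δ := (n * r) ^ (-1 / P) with hδ
    have hδ0 : 0 < δ := by positivity
    have hea : e ^ α ≤ δ ^ (α - P) * z ^ P + δ ^ α := by
      rcases le_total z δ with hzδ | hzδ
      · calc e ^ α ≤ δ ^ α := by gcongr; exact hez.trans hzδ
          _ ≤ _ := le_add_of_nonneg_left (by positivity)
      · calc e ^ α ≤ z ^ α := by gcongr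
          _ = z ^ (α - P) * z ^ P := by rw [← Real.rpow_add hz]; ring_nf
          _ ≤ δ ^ (α - P) * z ^ P := by
              gcongr 1
              exact Real.rpow_le_rpow_of_nonpos hδ0 hzδ (by linarith)
          _ ≤ _ := le_add_of_nonneg_right (by positivity)
    have e1 : δ ^ α = n ^ (-α / P) * r ^ (-α / P) := by
      rw [hδ, ← Real.rpow_mul (by positivity), ← Real.mul_rpow hn.le hr0.le]; ring_nf
    have e2 : δ ^ (α - P) = n ^ (1 - α / P) * r ^ (1 - α / P) := by
      rw [hδ, ← Real.rpow_mul (by positivity), ← Real.mul_rpow hn.le hr0.le]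
      congr 1; field_simp; ring
    have e3 : r⁻¹ * r ^ (-α / P) = r ^ (-1 - α / P) := by
      rw [← Real.rpow_neg_one r, ← Real.rpow_add hr0]; ring_nf
    have e4 : r⁻¹ * r ^ (1 - α / P) ≤ 1 := by
      rw [← Real.rpow_neg_one r, ← Real.rpow_add hr0]
      exact Real.rpow_le_one_of_one_le_of_nonpos hr (by
        have : 0 < α / P := by positivity
        linarith)
    calc s * e ^ α ≤ w * r⁻¹ * (δ ^ (α - P) * z ^ P + δ ^ α) := by gcongr
      _ = w * n ^ (1 - α / P) * z ^ P * (r⁻¹ * r ^ (1 - α / P))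
          + w * n ^ (-α / P) * (r⁻¹ * r ^ (-α / P)) := by rw [e1, e2]; ring
      _ ≤ w * n ^ (1 - α / P) * z ^ P * 1 + w * n ^ (-α / P) * r ^ (-1 - α / P) := by
          rw [e3]; gcongr
      _ = _ := by ring

/-- The quantization error in a coordinate below `n`, for a grid of width
`n ^ (-1 / P) * r ^ β`. -/
lemma mul_rpow_le_of_le_one {α P γ C : ℝ} (hα0 : 0 < α) {β : ℕ} (hβ : γ ≤ β * α)
    {n r w s e : ℝ} (hC : 0 ≤ C)
    (hn : 0 < n) (hr0 : 0 < r) (hr : r ≤ 1) (hw : 0 ≤ w)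
    (hs : s ≤ C * r ^ (-γ) * w)
    (he0 : 0 ≤ e) (hen : e ≤ n ^ (-1 / P) * r ^ β) :
    s * e ^ α ≤ w * n ^ (-α / P) * C := by
  have h1 : r ^ (-γ) * r ^ (β * α) ≤ 1 := by
    rw [← Real.rpow_add hr0]
    exact Real.rpow_le_one hr0.le hr (by linarith)
  calc s * e ^ α ≤ C * r ^ (-γ) * w * (n ^ (-1 / P) * r ^ β) ^ α := by gcongr
    _ = w * n ^ (-α / P) * C * (r ^ (-γ) * r ^ (β * α)) := by
        rw [Real.mul_rpow (by positivity) (by positivity), ← Real.rpow_mul hn.le,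
          ← Real.rpow_natCast_mul hr0.le]
        ring_nf
    _ ≤ w * n ^ (-α / P) * C * 1 := by gcongr
    _ = _ := mul_one _

lemma norm_toLp_le {α : ℝ} (hα0 : 0 < α) {σ : Measure ℕ} {s : ℕ → ℝ}
    (hs0 : ∀ k, 0 ≤ s k) (hs : ∀ k, σ {k} = ENNReal.ofReal (s k)) {f : ℕ → ℝ}
    (hf : MemLp f (ENNReal.ofReal α) σ) {c : ℕ → ℝ} (hfc : ∀ k, s k * |f k| ^ α ≤ c k)
    {D : ℝ} (hc : HasSum c D) : ‖hf.toLp f‖ ≤ D ^ (1 / α) := by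
  have hc0 : ∀ k, 0 ≤ c k := fun k =>
    le_trans (mul_nonneg (hs0 k) (Real.rpow_nonneg (abs_nonneg _) _)) (hfc k)
  rw [Lp.norm_toLp, eLpNorm_eq_lintegral_rpow_enorm_toReal (by simpa using hα0)
    ENNReal.ofReal_ne_top, ENNReal.toReal_ofReal hα0.le]
  refine ENNReal.toReal_le_of_le_ofReal (Real.rpow_nonneg (hc.nonneg hc0) _) ?_
  rw [← ENNReal.ofReal_rpow_of_nonneg (hc.nonneg hc0) (by positivity)]
  gcongr
  rw [lintegral_countable', ← hc.tsum_eq, ENNReal.ofReal_tsum_of_nonneg hc0 hc.summable]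
  refine ENNReal.tsum_le_tsum fun k => ?_
  rw [hs, Real.enorm_eq_ofReal_abs, ENNReal.ofReal_rpow_of_nonneg (abs_nonneg _) hα0.le,
    ← ENNReal.ofReal_mul (by positivity)]
  apply ENNReal.ofReal_le_ofReal
  rw [mul_comm]
  exact hfc k

/-! ### Entropy numbers of the embedding from above -/

lemma entropyNumber_le_of_cover {E F ι : Type*} [Norm E] [Norm F] [Sub F] [Zero F] {T : E → F}
    {N : ℕ} (M : Finset ι) (y : ι → F) (hM : M.card ≤ 2 ^ (N - 1)) {ε : ℝ} (hε : 0 < ε)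
    (h : ∀ z, ‖z‖ ≤ 1 → ∃ m ∈ M, ‖T z - y m‖ ≤ ε) : entropyNumber T N ≤ ε := by
  obtain ⟨e⟩ : Nonempty (M ↪ Fin (2 ^ (N - 1))) :=
    Function.Embedding.nonempty_of_card_le (by simpa using hM)
  refine csInf_le ⟨0, fun _ h => h.1.le⟩
    ⟨hε, Function.extend e (fun m : M => y m) (fun _ => 0), fun z hz => ?_⟩
  obtain ⟨m, hm, hle⟩ := h z hz
  refine ⟨e ⟨m, hm⟩, ?_⟩
  rwa [e.injective.extend_apply]

/-- The width of the quantization grid in coordinate `k`, as a multiple of `n ^ (-1 / p)`: with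
`r = (k + 1) / n` it is `r ^ β` for `k < n` and `r` for `k ≥ n`. -/
noncomputable def gridWidth (n β k : ℕ) : ℝ :=
  if k < n then (((k : ℝ) + 1) / n) ^ β else ((k : ℝ) + 1) / n

lemma gridWidth_pos {n : ℕ} (hn : 1 ≤ n) (β k : ℕ) : 0 < gridWidth n β k := by
  have hn' : (0 : ℝ) < n := by exact_mod_cast hn
  unfold gridWidth
  split_ifs <;> positivity

/-- The function on `ℕ` with values `δ k * m k` for `k < K` and `0` beyond. -/
def latticeFun {K : ℕ} (δ : ℕ → ℝ) (m : Fin K → ℤ) (k : ℕ) : ℝ :=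
  if h : k < K then m ⟨k, h⟩ * δ k else 0

lemma memLp_latticeFun {K : ℕ} (δ : ℕ → ℝ) (m : Fin K → ℤ) (q : ℝ≥0∞) (σ : Measure ℕ)
    [IsFiniteMeasure σ] : MemLp (latticeFun δ m) q σ := by
  refine MemLp.of_bound (measurable_of_countable _).aestronglyMeasurable
    (∑ i : Fin K, |(m i : ℝ) * δ i|) (ae_of_all _ fun k => ?_)
  unfold latticeFun
  split_ifs with h
  · exact Finset.single_le_sum (f := fun i : Fin K => |(m i : ℝ) * δ i|)
      (fun _ _ => abs_nonneg _) (Finset.mem_univ (⟨k, h⟩ : Fin K))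
  · rw [norm_zero]
    exact Finset.sum_nonneg fun _ _ => abs_nonneg _

/-- Upper bound for the entropy numbers of the embedding, for weights that decrease at most
polynomially up to `n` and at least like `1 / k` after `n`. -/
theorem entropyNumber_embeddingLp_le {α : ℝ} (hα0 : 0 < α) (hα2 : α < 2) {p : ℝ≥0∞} (hp1 : 1 ≤ p)
    (hp : p ≠ ∞) {C γ : ℝ} (hC : 0 ≤ C) :
    ∃ (L : ℕ) (C' : ℝ), 0 < L ∧ 0 < C' ∧ ∀ (σ : Measure ℕ) [IsFiniteMeasure σ] (s : ℕ → ℝ),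
      (∀ k, 0 ≤ s k) → (∀ k, σ {k} = ENNReal.ofReal (s k)) → ∀ (n : ℕ) (w : ℝ), 1 ≤ n → 0 < w →
      (∀ k < n, s k ≤ C * (((k : ℝ) + 1) / n) ^ (-γ) * w) →
      (∀ k, n ≤ k → s k ≤ w * (((k : ℝ) + 1) / n)⁻¹) →
      ∀ N, L * n ≤ N - 1 → entropyNumber (embeddingLp p α σ) N ≤
        C' * (w * (n : ℝ) ^ (1 - α / p.toReal)) ^ (1 / α) := by
  set P := p.toReal with hPdef
  have hP : 1 ≤ P := by
    have := ENNReal.toReal_mono hp hp1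
    simpa using this
  have hP0 : 0 < P := by linarith
  obtain ⟨β, hβ⟩ := exists_nat_ge (γ / α)
  rw [div_le_iff₀ hα0] at hβ
  obtain ⟨B, hB⟩ := exists_nat_ge (β * P)
  have hαP : 0 < α / P := by positivity
  refine ⟨2 * (B + 7), (1 + C + (α / P)⁻¹) ^ (1 / α), by omega, by positivity, ?_⟩
  intro σ _ s hs0 hs n w hn hw h1 h2 N hN
  have hn' : (0 : ℝ) < n := by exact_mod_cast hn
  have hn1 : (1 : ℝ) ≤ n := by exact_mod_cast hn
  set K := n ^ 2 with hK
  have hnK : n ≤ K := by rw [hK]; nlinarith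
  set δ : ℕ → ℝ := fun k => (n : ℝ) ^ (-1 / P) * gridWidth n β k with hδdef
  have hδ : ∀ k, 0 < δ k := fun k => mul_pos (by positivity) (gridWidth_pos hn β k)
  set G : Fin K → ℝ := fun k => gridWidth n β k ^ P with hGdef
  have hGδ : ∀ k : Fin K, G k = n * δ k ^ P := fun k => by
    simp only [hGdef, hδdef]
    rw [Real.mul_rpow (by positivity) (gridWidth_pos hn β k).le, ← Real.rpow_mul hn'.le,
      div_mul_cancel₀ _ hP0.ne', Real.rpow_neg_one]
    field_simp
  have hG : ∀ k, 0 < G k := fun k => Real.rpow_pos_of_pos (gridWidth_pos hn β k) _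
  have hG1 : ∀ k : Fin K, (k : ℕ) < n → (((k : ℕ) + 1 : ℝ) / n) ^ B ≤ G k := by
    intro k hk
    simp only [hGdef, gridWidth, if_pos hk]
    rw [← Real.rpow_natCast, ← Real.rpow_natCast, ← Real.rpow_mul (by positivity)]
    refine Real.rpow_le_rpow_of_exponent_ge (by positivity) ?_ hB
    rw [div_le_one hn']
    exact_mod_cast hk
  have hr1 : ∀ k : ℕ, n ≤ k → (1 : ℝ) ≤ ((k : ℝ) + 1) / n := fun k hk => by
    rw [le_div_iff₀ hn', one_mul]
    have : (n : ℝ) ≤ k := by exact_mod_cast hk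
    linarith
  have hG2 : ∀ k : Fin K, n ≤ (k : ℕ) → ((k : ℕ) + 1 : ℝ) / n ≤ G k := by
    intro k hk
    simp only [hGdef, gridWidth, if_neg hk.not_gt]
    exact Real.self_le_rpow_of_one_le (hr1 k hk) hP
  let t : Fin K → Finset ℤ := fun k => Finset.Icc (-⌈n / G k⌉) ⌈n / G k⌉
  let M : Finset (Fin K → ℤ) :=
    (Fintype.piFinset t).filter fun m => ∑ k, G k * |(m k : ℝ)| ≤ n
  have hMcard : M.card ≤ 2 ^ (N - 1) :=
    (card_lattice_points_le hn hnK hG1 hG2 t M (Finset.filter_subset _ _)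
      fun m hm => (Finset.mem_filter.1 hm).2).trans (Nat.pow_le_pow_right (by norm_num) hN)
  set D := (1 + C + (α / P)⁻¹) * (w * (n : ℝ) ^ (1 - α / P)) with hD
  have hDpos : 0 < D := by positivity
  rw [← Real.mul_rpow (by positivity) (by positivity), ← hD]
  refine entropyNumber_le_of_cover M
    (fun m => (memLp_latticeFun δ m (ENNReal.ofReal α) σ).toLp _) hMcard (by positivity) ?_
  intro z hz
  choose m hm1 hm2 hm3 using fun k : ℕ => exists_int_mul_truncate (z k) (hδ k)
  have hzsum : HasSum (fun k => |z k| ^ P) (‖z‖ ^ P) := by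
    simpa using lp.hasSum_norm hP0 z
  have hz1 : ‖z‖ ^ P ≤ 1 := Real.rpow_le_one (lp.norm_nonneg' _) hz hP0.le
  have hGm : ∀ k : Fin K, G k * |(m k : ℝ)| ≤ n * |z k| ^ P := by
    intro k
    rw [hGδ, mul_assoc]
    refine mul_le_mul_of_nonneg_left ?_ hn'.le
    have e1 : |(m k : ℝ)| ≤ |(m k : ℝ)| ^ P := by
      rcases eq_or_ne (m k) 0 with h0 | h0
      · simp [h0, Real.zero_rpow hP0.ne']
      · refine Real.self_le_rpow_of_one_le ?_ hP
        exact_mod_cast Int.one_le_abs h0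
    calc δ k ^ P * |(m k : ℝ)| ≤ δ k ^ P * |(m k : ℝ)| ^ P := by
          gcongr; exact (Real.rpow_pos_of_pos (hδ k) _).le
      _ = (|(m k : ℝ)| * δ k) ^ P := by
          rw [Real.mul_rpow (abs_nonneg _) (hδ k).le, mul_comm]
      _ ≤ |z k| ^ P := by
          refine Real.rpow_le_rpow (mul_nonneg (abs_nonneg _) (hδ k).le) (hm1 k) hP0.le
  have hGsum : ∑ k : Fin K, G k * |(m k : ℝ)| ≤ n := by
    calc ∑ k : Fin K, G k * |(m k : ℝ)| ≤ ∑ k : Fin K, n * |z k| ^ P :=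
          Finset.sum_le_sum fun k _ => hGm k
      _ = n * ∑ k ∈ Finset.range K, |z k| ^ P := by
          rw [← Finset.mul_sum, Fin.sum_univ_eq_sum_range (fun k => |z k| ^ P)]
      _ ≤ n * 1 := by
          gcongr
          exact (sum_le_hasSum _ (fun _ _ => by positivity) hzsum).trans hz1
      _ = n := mul_one _
  refine ⟨fun k => m k, ?_, ?_⟩
  · refine Finset.mem_filter.2 ⟨Fintype.mem_piFinset.2 fun k => ?_, hGsum⟩
    have e1 : G k * |(m k : ℝ)| ≤ n :=
      (Finset.single_le_sum (f := fun k : Fin K => G k * |(m k : ℝ)|)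
        (fun k _ => mul_nonneg (hG k).le (abs_nonneg _)) (Finset.mem_univ k)).trans hGsum
    have e2 : |(m k : ℝ)| ≤ n / G k := by rw [le_div_iff₀ (hG k)]; linarith
    have e3 : |(m k : ℝ)| ≤ (⌈n / G k⌉ : ℤ) := e2.trans (Int.le_ceil _)
    have e4 : |m k| ≤ ⌈n / G k⌉ := by exact_mod_cast e3
    exact Finset.mem_Icc.2 (abs_le.1 e4)
  -- Beyond `K = n ^ 2` the grid is wider than `1`, so that `0` is within the grid width of `z k`.
  have herr : ∀ k, |z k - latticeFun δ (fun k : Fin K => m k) k| ≤ δ k ∧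
      |z k - latticeFun δ (fun k : Fin K => m k) k| ≤ |z k| := by
    intro k
    unfold latticeFun
    split_ifs with hk
    · exact ⟨hm2 k, hm3 k⟩
    · rw [sub_zero]
      refine ⟨?_, le_rfl⟩
      have hk' : K ≤ k := not_lt.1 hk
      have e1 : |z k| ≤ 1 := (lp.norm_apply_le_norm (by positivity) z k).trans hz
      refine e1.trans ?_
      simp only [hδdef, gridWidth, if_neg (hnK.trans hk').not_gt]
      have e2 : (n : ℝ) ≤ ((k : ℝ) + 1) / n := by
        rw [le_div_iff₀ hn']
        have : ((n ^ 2 : ℕ) : ℝ) ≤ k := by exact_mod_cast hk'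
        push_cast at this
        nlinarith
      calc (1 : ℝ) = (n : ℝ) ^ (-1 : ℝ) * n := by
            rw [Real.rpow_neg_one]; field_simp
        _ ≤ (n : ℝ) ^ (-1 / P) * (((k : ℝ) + 1) / n) := by
            gcongr
            rw [le_div_iff₀ hP0]; linarith
  set A := w * (n : ℝ) ^ (1 - α / P) with hA
  let b : ℕ → ℝ := fun k => w * (n : ℝ) ^ (-α / P) *
    (if k < n then C else (((k : ℝ) + 1) / n) ^ (-1 - α / P))
  have hb0 : ∀ k, 0 ≤ b k := fun k => by
    simp only [b]; split_ifs <;> positivity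
  have hbsum : ∀ K' : ℕ, ∑ k ∈ Finset.range K', b k ≤ A * (C + (α / P)⁻¹) := by
    intro K'
    calc ∑ k ∈ Finset.range K', b k ≤ ∑ k ∈ Finset.range (max n K'), b k :=
          Finset.sum_le_sum_of_subset_of_nonneg
            (Finset.range_mono (le_max_right _ _)) fun k _ _ => hb0 k
      _ = w * (n : ℝ) ^ (-α / P) * (n * C
          + ∑ k ∈ Finset.Ico n (max n K'), (((k : ℝ) + 1) / n) ^ (-1 - α / P)) := by
          rw [← Finset.mul_sum, ← Finset.sum_range_add_sum_Ico _ (le_max_left n K')]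
          congr 2
          · rw [Finset.sum_congr rfl fun k hk => if_pos (Finset.mem_range.1 hk)]
            simp
          · exact Finset.sum_congr rfl fun k hk => if_neg (Finset.mem_Ico.1 hk).1.not_gt
      _ ≤ w * (n : ℝ) ^ (-α / P) * (n * C + n / (α / P)) := by
          gcongr
          exact sum_Ico_rpow_le hαP hn (le_max_left _ _)
      _ = A * (C + (α / P)⁻¹) := by
          rw [hA, show (1 : ℝ) - α / P = 1 + -α / P by ring, Real.rpow_add hn', Real.rpow_one]
          ring
  have hbS : Summable b := summable_of_sum_range_le hb0 hbsum
  have hbD : ∑' k, b k ≤ A * (C + (α / P)⁻¹) := hbS.tsum_le_of_sum_range_le hbsum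
  have hfc : ∀ k, s k * |((fun k => z k) - latticeFun δ (fun k : Fin K => m k)) k| ^ α
      ≤ A * |z k| ^ P + b k := by
    intro k
    obtain ⟨e1, e2⟩ := herr k
    rw [Pi.sub_apply]
    simp only [hδdef, gridWidth] at e1
    simp only [b]
    split_ifs at e1 ⊢ with hk
    · have hr : ((k : ℝ) + 1) / n ≤ 1 := by
        rw [div_le_one hn']; exact_mod_cast hk
      refine (mul_rpow_le_of_le_one hα0 hβ hC hn' (by positivity) hr hw.le
        (h1 k hk) (abs_nonneg _) e1).trans ?_
      exact le_add_of_nonneg_left (by positivity)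
    · exact mul_rpow_le_of_one_le hα0 hα2 hP hn' (hr1 k (not_lt.1 hk)) hw.le
        (h2 k (not_lt.1 hk)) (abs_nonneg _) e2 e1
  have hcs : HasSum (fun k => A * |z k| ^ P + b k) (A * ‖z‖ ^ P + ∑' k, b k) :=
    (hzsum.mul_left A).add hbS.hasSum
  unfold embeddingLp
  rw [← MemLp.toLp_sub]
  refine (norm_toLp_le hα0 hs0 hs _ hfc hcs).trans ?_
  have hA0 : 0 < A := by positivity
  refine Real.rpow_le_rpow (hcs.nonneg fun k => ?_) ?_ (by positivity)
  · have := hb0 k; positivity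
  · rw [hD]
    nlinarith [mul_le_mul_of_nonneg_left hz1 hA0.le]

/-! ### Distinct values among independent draws -/

/-- The values `≥ n` among the first `j` terms of the sequence `x`. -/
def tailValues (n j : ℕ) (x : ℕ → ℕ) : Finset ℕ := ((Finset.range j).image x).filter (n ≤ ·)

lemma tailValues_succ (n j : ℕ) (x : ℕ → ℕ) : tailValues n (j + 1) x =
    if n ≤ x j then insert (x j) (tailValues n j x) else tailValues n j x := by
  simp [tailValues, Finset.range_add_one, Finset.image_insert, Finset.filter_insert]

/-- The weight `2 ^ (-i)`, killed at level `R`. -/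
noncomputable def killedWeight (R i : ℕ) : ℝ≥0∞ := if i < R then 2⁻¹ ^ i else 0

lemma killedWeight_anti (R : ℕ) : Antitone (killedWeight R) := by
  intro i j hij
  unfold killedWeight
  split_ifs with h1 h2 h2
  · exact pow_le_pow_of_le_one (by simp) (by simp) hij
  · omega
  · simp
  · simp

lemma killedWeight_succ_le (R i : ℕ) : killedWeight R (i + 1) ≤ killedWeight R i * 2⁻¹ := by
  unfold killedWeight
  split_ifs with h1 h2 h2
  · rw [pow_succ]
  · omega
  · simp
  · simp

/-- One more draw multiplies the expected killed weight by at most `1 - q / 2`, if a new value is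
drawn with probability at least `q` as long as fewer than `R` values have been seen. -/
lemma lintegral_killedWeight_draw_le {σ : Measure ℕ} [IsProbabilityMeasure σ] {n R : ℕ} {q : ℝ}
    (hq : ∀ A : Finset ℕ, A.card < R → q ≤ σ.real (Set.Ici n \ A)) (A : Finset ℕ) :
    ∫⁻ v, killedWeight R (if n ≤ v then insert v A else A).card ∂σ ≤
      ENNReal.ofReal (1 - q / 2) * killedWeight R A.card := by
  have hmono : ∀ v, killedWeight R (if n ≤ v then insert v A else A).card
      ≤ killedWeight R A.card := fun v => by
    refine killedWeight_anti R ?_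
    split_ifs
    · exact Finset.card_le_card (Finset.subset_insert _ _)
    · exact le_rfl
  rcases le_or_gt R A.card with hR | hR
  · have h0 : killedWeight R A.card = 0 := if_neg hR.not_gt
    rw [h0, mul_zero, nonpos_iff_eq_zero, ← lintegral_zero (μ := σ)]
    exact lintegral_congr fun v => le_antisymm ((hmono v).trans_eq h0) zero_le
  · set E : Set ℕ := Set.Ici n \ A with hE
    have hEm : MeasurableSet E := MeasurableSet.of_discrete
    have hnew : ∀ v ∈ E, killedWeight R (if n ≤ v then insert v A else A).card
        ≤ killedWeight R A.card * 2⁻¹ := by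
      intro v hv
      have hv1 : n ≤ v := hv.1
      have hv2 : v ∉ A := hv.2
      rw [if_pos hv1, Finset.card_insert_of_notMem hv2]
      exact killedWeight_succ_le R _
    have hσ : 2⁻¹ * σ E + σ Eᶜ ≤ ENNReal.ofReal (1 - q / 2) := by
      have h1 := hq A hR
      have h2 : σ.real E ≤ 1 := measureReal_le_one
      rw [prob_compl_eq_one_sub hEm, ← ofReal_measureReal (μ := σ) (s := E),
        ← ENNReal.ofReal_one, ← ENNReal.ofReal_sub _ measureReal_nonneg,
        show (2⁻¹ : ℝ≥0∞) = ENNReal.ofReal 2⁻¹ by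
          rw [ENNReal.ofReal_inv_of_pos two_pos]; simp,
        ← ENNReal.ofReal_mul (by norm_num), ← ENNReal.ofReal_add (by positivity) (by linarith)]
      apply ENNReal.ofReal_le_ofReal
      linarith
    rw [← lintegral_add_compl _ hEm]
    calc _ ≤ ∫⁻ _ in E, killedWeight R A.card * 2⁻¹ ∂σ + ∫⁻ _ in Eᶜ, killedWeight R A.card ∂σ :=
          add_le_add (setLIntegral_mono' hEm hnew) (lintegral_mono fun v => hmono v)
      _ = (2⁻¹ * σ E + σ Eᶜ) * killedWeight R A.card := by
          rw [setLIntegral_const, setLIntegral_const]; ring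
      _ ≤ _ := by gcongr

lemma lintegral_killedWeight_succ_le {Ω : Type*} [MeasurableSpace Ω] {Q : Measure Ω}
    [IsProbabilityMeasure Q] {σ : Measure ℕ} [IsProbabilityMeasure σ] {V : ℕ → Ω → ℕ}
    (hVm : ∀ j, Measurable (V j)) (hVl : ∀ j, Q.map (V j) = σ) (hVi : iIndepFun V Q)
    {n R : ℕ} {q : ℝ} (hq : ∀ A : Finset ℕ, A.card < R → q ≤ σ.real (Set.Ici n \ A)) (j : ℕ) :
    ∫⁻ ω, killedWeight R (tailValues n (j + 1) (V · ω)).card ∂Q ≤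
      ENNReal.ofReal (1 - q / 2) * ∫⁻ ω, killedWeight R (tailValues n j (V · ω)).card ∂Q := by
  let X : Ω → (Finset.range j → ℕ) := fun ω i => V i ω
  have hXm : Measurable X := measurable_pi_lambda _ fun i => hVm i
  have hind : IndepFun X (V j) Q := by
    have h := hVi.indepFun_finset (Finset.range j) {j} (by simp) hVm
    exact h.comp (φ := id) (ψ := fun y : ({j} : Finset ℕ) → ℕ => y ⟨j, by simp⟩)
      measurable_id (measurable_pi_apply _)
  let S : (Finset.range j → ℕ) → Finset ℕ := fun x => (Finset.univ.image x).filter (n ≤ ·)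
  have hS : ∀ ω, tailValues n j (V · ω) = S (X ω) := by
    intro ω
    ext a
    simp [tailValues, S, X]
  let F : (Finset.range j → ℕ) × ℕ → ℝ≥0∞ := fun y =>
    killedWeight R (if n ≤ y.2 then insert y.2 (S y.1) else S y.1).card
  have hF : Measurable F := measurable_of_countable _
  have hSm : Measurable fun x => killedWeight R (S x).card := measurable_of_countable _
  have hlaw := (indepFun_iff_map_prod_eq_prod_map_map hXm.aemeasurable
    (hVm j).aemeasurable).1 hind
  rw [hVl j] at hlaw
  calc ∫⁻ ω, killedWeight R (tailValues n (j + 1) (V · ω)).card ∂Q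
      = ∫⁻ ω, F (X ω, V j ω) ∂Q := by
        refine lintegral_congr fun ω => ?_
        rw [tailValues_succ, hS]
    _ = ∫⁻ y, F y ∂((Q.map X).prod σ) := by
        rw [← hlaw, lintegral_map hF (hXm.prodMk (hVm j))]
    _ = ∫⁻ x, ∫⁻ v, F (x, v) ∂σ ∂(Q.map X) := lintegral_prod _ hF.aemeasurable
    _ ≤ ∫⁻ x, ENNReal.ofReal (1 - q / 2) * killedWeight R (S x).card ∂(Q.map X) :=
        lintegral_mono fun x => lintegral_killedWeight_draw_le hq (S x)
    _ = ENNReal.ofReal (1 - q / 2) * ∫⁻ ω, killedWeight R (S (X ω)).card ∂Q := by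
        rw [lintegral_const_mul _ hSm, lintegral_map hSm hXm]
    _ = _ := by simp_rw [hS]

lemma measure_card_tailValues_lt_le {Ω : Type*} [MeasurableSpace Ω] {Q : Measure Ω}
    [IsProbabilityMeasure Q] {σ : Measure ℕ} [IsProbabilityMeasure σ] {V : ℕ → Ω → ℕ}
    (hVm : ∀ j, Measurable (V j)) (hVl : ∀ j, Q.map (V j) = σ) (hVi : iIndepFun V Q)
    {n R : ℕ} {q : ℝ} (hq : ∀ A : Finset ℕ, A.card < R → q ≤ σ.real (Set.Ici n \ A)) (m : ℕ) :
    Q {ω | (tailValues n m (V · ω)).card < R} ≤ 2 ^ R * ENNReal.ofReal (1 - q / 2) ^ m := by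
  have h1 : ∫⁻ ω, killedWeight R (tailValues n m (V · ω)).card ∂Q ≤
      ENNReal.ofReal (1 - q / 2) ^ m := by
    induction m with
    | zero =>
      calc _ ≤ ∫⁻ _, 1 ∂Q := lintegral_mono fun ω => by
            unfold killedWeight
            split_ifs
            · exact pow_le_one' (by simp) _
            · exact zero_le
        _ = _ := by simp
    | succ m ih =>
      refine (lintegral_killedWeight_succ_le hVm hVl hVi hq m).trans ?_
      rw [pow_succ']
      gcongr
  have h2 : ((2 : ℝ≥0∞) ^ R)⁻¹ * Q {ω | (tailValues n m (V · ω)).card < R} ≤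
      ENNReal.ofReal (1 - q / 2) ^ m := by
    refine le_trans ?_ h1
    refine le_trans ?_ (mul_meas_ge_le_lintegral₀ ?_ ((2 : ℝ≥0∞) ^ R)⁻¹)
    · refine mul_le_mul' le_rfl (measure_mono fun ω hω => ?_)
      have hω : (tailValues n m (V · ω)).card < R := hω
      rw [Set.mem_ofPred_eq, killedWeight, if_pos hω, ENNReal.inv_pow]
      exact pow_le_pow_of_le_one (by simp) (by simp) hω.le
    · refine Measurable.aemeasurable ?_
      let S : (Finset.range m → ℕ) → Finset ℕ := fun x => (Finset.univ.image x).filter (n ≤ ·)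
      have hS : ∀ ω, tailValues n m (V · ω) = S (fun i => V i ω) := by
        intro ω
        ext a
        simp [tailValues, S]
      simp_rw [hS]
      exact (measurable_of_countable fun x => killedWeight R (S x).card).comp
        (measurable_pi_lambda _ fun i => hVm i)
  calc Q {ω | (tailValues n m (V · ω)).card < R}
      = 2 ^ R * ((2 ^ R)⁻¹ * Q {ω | (tailValues n m (V · ω)).card < R}) := by
        rw [← mul_assoc, ENNReal.mul_inv_cancel (by simp) (by simp), one_mul]
    _ ≤ _ := by gcongr

/-! ### Positivity of the entropy numbers of the embedding -/

lemma ae_eq_apply {σ : Measure ℕ} {f g : ℕ → ℝ} (h : f =ᵐ[σ] g) {k : ℕ} (hk : 0 < σ {k}) :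
    f k = g k := by
  by_contra hne
  exact hk.ne' (measure_mono_null (by simpa using hne) (ae_iff.1 h))

lemma abs_apply_mul_le_norm {α : ℝ} (hα0 : 0 < α) {σ : Measure ℕ} [IsFiniteMeasure σ]
    (f : Lp ℝ (ENNReal.ofReal α) σ) (k : ℕ) :
    |f k| * σ.real {k} ^ (1 / α) ≤ ‖f‖ := by
  rw [Lp.norm_def]
  refine (ENNReal.ofReal_le_iff_le_toReal (Lp.eLpNorm_ne_top f)).1 ?_
  rw [eLpNorm_eq_lintegral_rpow_enorm_toReal (by simpa using hα0)
    ENNReal.ofReal_ne_top, ENNReal.toReal_ofReal hα0.le]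
  have e : |f k| * σ.real {k} ^ (1 / α) = (|f k| ^ α * σ.real {k}) ^ (1 / α) := by
    rw [Real.mul_rpow (by positivity) measureReal_nonneg, ← Real.rpow_mul (abs_nonneg _),
      mul_one_div_cancel hα0.ne', Real.rpow_one]
  have h0 : 0 ≤ |f k| ^ α * σ.real {k} := mul_nonneg (by positivity) measureReal_nonneg
  rw [e, ← ENNReal.ofReal_rpow_of_nonneg h0 (by positivity)]
  gcongr
  rw [lintegral_countable']
  refine le_trans (le_of_eq ?_) (ENNReal.le_tsum k)
  rw [ENNReal.ofReal_mul (by positivity), ofReal_measureReal, Real.enorm_eq_ofReal_abs,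
    ENNReal.ofReal_rpow_of_nonneg (abs_nonneg _) hα0.le]

/-- The entropy numbers of the embedding are positive: already the segment `[0, 1] · e₀` cannot be
covered by finitely many arbitrarily small balls. -/
lemma entropyNumber_embeddingLp_pos {α : ℝ} (hα0 : 0 < α) {p : ℝ≥0∞} (hp1 : 1 ≤ p)
    {σ : Measure ℕ} [IsProbabilityMeasure σ] (hσ : ∀ k, 0 < σ {k}) (N : ℕ) :
    0 < entropyNumber (embeddingLp p α σ) N := by
  have hp0 : 0 < p := one_pos.trans_le hp1
  set K := 2 ^ (N - 1) with hK
  have hKpos : (0 : ℝ) < K := by rw [hK]; positivity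
  set s := σ.real {0} ^ (1 / α) with hs
  have hspos : 0 < s := Real.rpow_pos_of_pos
    (ENNReal.toReal_pos (hσ 0).ne' (measure_ne_top _ _)) _
  refine lt_of_lt_of_le (b := s / (2 * K)) (by positivity) (le_csInf ?_ ?_)
  · refine ⟨1, one_pos, fun _ => 0, fun z hz => ⟨⟨0, by positivity⟩, ?_⟩⟩
    rw [sub_zero]
    have hsum : HasSum (fun k => σ.real {k}) 1 := by
      have h1 : ∑' k : ℕ, σ {k} = 1 := by
        rw [← lintegral_one (μ := σ) |>.trans measure_univ, lintegral_countable']; simp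
      have h2 := ENNReal.hasSum_toReal (f := fun k : ℕ => σ {k}) (by simp [h1])
      rw [← ENNReal.tsum_toReal_eq (fun k => measure_ne_top _ _), h1] at h2
      simpa [Measure.real] using h2
    refine (norm_toLp_le hα0 (fun k => measureReal_nonneg)
      (fun k => (ofReal_measureReal).symm) _ (fun k => ?_) hsum).trans (by simp)
    have h1 : |z k| ≤ 1 := (lp.norm_apply_le_norm hp0.ne' z k).trans hz
    exact mul_le_of_le_one_right measureReal_nonneg
      (Real.rpow_le_one (abs_nonneg _) h1 hα0.le)
  · rintro ε ⟨hε, y, hy⟩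
    let z : Fin (K + 1) → SeqLp p := fun i => lp.single p 0 (((i : ℕ) : ℝ) / K)
    have hz : ∀ i, ‖z i‖ ≤ 1 := fun i => by
      simp only [z]
      rw [lp.norm_single hp0, Real.norm_eq_abs, abs_of_nonneg (by positivity),
        div_le_one hKpos]
      exact_mod_cast Nat.lt_succ_iff.1 i.2
    choose c hc using fun i => hy (z i) (hz i)
    obtain ⟨i, i', hne, hii⟩ := Fintype.exists_ne_map_eq_of_card_lt c (by simp [hK])
    have key : ∀ j : Fin (K + 1), |((j : ℕ) : ℝ) / K - y (c j) 0| * s ≤ ε := by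
      intro j
      refine le_trans (le_of_eq ?_) ((abs_apply_mul_le_norm hα0 _ 0).trans (hc j))
      rw [ae_eq_apply (Lp.coeFn_sub _ _) (hσ 0), Pi.sub_apply]
      unfold embeddingLp
      rw [ae_eq_apply (MemLp.coeFn_toLp _) (hσ 0)]
      simp [z, hs]
    have h1 := key i
    have h2 := key i'
    rw [← hii] at h2
    have h3 : 1 / (K : ℝ) ≤ |((i : ℕ) : ℝ) / K - ((i' : ℕ) : ℝ) / K| := by
      rw [← sub_div, abs_div, abs_of_pos hKpos]
      gcongr
      have : (i : ℤ) - (i' : ℤ) ≠ 0 := by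
        intro h
        exact hne (Fin.ext (by omega))
      exact_mod_cast Int.one_le_abs this
    have h4 := abs_sub_le (((i : ℕ) : ℝ) / K) (y (c i) 0) (((i' : ℕ) : ℝ) / K)
    rw [abs_sub_comm (y (c i) 0)] at h4
    have h5 : 1 / (K : ℝ) * s ≤ 2 * ε := by
      nlinarith [mul_le_mul_of_nonneg_right (h3.trans h4) hspos.le]
    rw [div_le_iff₀ (by positivity)]
    rw [div_mul_eq_mul_div, one_mul, div_le_iff₀ hKpos] at h5
    linarith

/-! ### The operator for a fixed realization -/

lemma exists_linear_bounds {g : ℕ → ℝ} (hg : ∀ j, 1 ≤ j → 0 < g j) {μ : ℝ} (hμ : 0 < μ)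
    (hlim : Tendsto (fun j : ℕ => g j / j) atTop (𝓝 μ)) :
    ∃ κ M : ℝ, 0 < κ ∧ 0 < M ∧ ∀ j : ℕ, 1 ≤ j → κ * j ≤ g j ∧ g j ≤ M * j := by
  obtain ⟨M, hM⟩ := hlim.bddAbove_range
  obtain ⟨W, hW⟩ := (hlim.inv₀ hμ.ne').bddAbove_range
  have hpos : ∀ j : ℕ, 1 ≤ j → (0 : ℝ) < j := fun j hj => by exact_mod_cast hj
  refine ⟨(max W 1)⁻¹, max M 1, by positivity, by positivity, fun j hj => ⟨?_, ?_⟩⟩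
  · have h1 : (g j / j)⁻¹ ≤ max W 1 := (hW ⟨j, rfl⟩).trans (le_max_left _ _)
    have h2 := hpos j hj
    have h3 := hg j hj
    rw [inv_div, div_le_iff₀ h3] at h1
    rw [inv_mul_le_iff₀ (by positivity)]
    exact h1
  · have h1 : g j / j ≤ max M 1 := (hM ⟨j, rfl⟩).trans (le_max_left _ _)
    exact (div_le_iff₀ (hpos j hj)).1 h1

section Realization

variable {α : ℝ} {p : ℝ≥0∞} {σ : Measure ℕ} {x : ℕ → ℕ} {ζ : ℕ → ℝ} {κ : ℝ}

lemma abs_randomSeq_le (hα0 : 0 < α) (hα2 : α < 2) (hp1 : 1 ≤ p) [IsProbabilityMeasure σ]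
    (hκ : 0 < κ) (hlow : ∀ j : ℕ, 1 ≤ j → κ * j ≤ ∑ i ∈ Finset.range j, ζ i)
    (z : SeqLp p) (j : ℕ) :
    |randomSeq α σ x ζ z j| ≤
      stableConst α * (κ ^ (-1 / α) * ((j : ℝ) + 1) ^ (-1 / α)) * ‖z‖ := by
  have hc := stableConst_pos hα0 hα2
  have h1 := hlow (j + 1) (by omega)
  push_cast at h1
  have h2 : 0 < κ * ((j : ℝ) + 1) := by positivity
  have h3 : |z (x j)| ≤ ‖z‖ := lp.norm_apply_le_norm (one_pos.trans_le hp1).ne' z (x j)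
  have hz0 : 0 ≤ ‖z‖ := (abs_nonneg _).trans h3
  have h4 : (∑ i ∈ Finset.range (j + 1), ζ i) ^ (-1 / α) ≤ κ ^ (-1 / α) * ((j : ℝ) + 1) ^ (-1 / α) := by
    rw [← Real.mul_rpow hκ.le (by positivity)]
    exact Real.rpow_le_rpow_of_nonpos h2 h1 (by rw [neg_div]; simp [hα0.le])
  have h5 : 0 ≤ (∑ i ∈ Finset.range (j + 1), ζ i) ^ (-1 / α) := Real.rpow_nonneg (by linarith) _
  unfold randomSeq
  rw [probReal_univ, Real.one_rpow, mul_one, abs_mul, abs_mul, abs_of_pos hc, abs_of_nonneg h5]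
  calc _ ≤ stableConst α * (‖z‖ * (κ ^ (-1 / α) * ((j : ℝ) + 1) ^ (-1 / α))) := by gcongr
    _ = _ := by ring

lemma summable_sq_rpow (hα0 : 0 < α) (hα2 : α < 2) (c : ℝ) :
    Summable fun j : ℕ => (c * (κ ^ (-1 / α) * ((j : ℝ) + 1) ^ (-1 / α))) ^ 2 := by
  have h1 : Summable fun j : ℕ => ((j + 1 : ℕ) : ℝ) ^ (-2 / α) :=
    (summable_nat_add_iff 1).2 (Real.summable_nat_rpow.2 (by
      rw [div_lt_iff₀ hα0]; linarith))
  refine (h1.mul_left ((c * κ ^ (-1 / α)) ^ 2)).congr fun j => ?_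
  have h2 : (((j : ℝ) + 1) ^ (-1 / α)) ^ 2 = ((j + 1 : ℕ) : ℝ) ^ (-2 / α) := by
    push_cast
    rw [← Real.rpow_mul_natCast (by positivity)]
    ring_nf
  rw [← h2]; ring

lemma memℓp_randomSeq (hα0 : 0 < α) (hα2 : α < 2) (hp1 : 1 ≤ p) [IsProbabilityMeasure σ]
    (hκ : 0 < κ) (hlow : ∀ j : ℕ, 1 ≤ j → κ * j ≤ ∑ i ∈ Finset.range j, ζ i) (z : SeqLp p) :
    Memℓp (fun j : ℕ => randomSeq α σ x ζ z j) 2 := by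
  refine memℓp_gen ?_
  refine ((summable_sq_rpow hα0 hα2 (κ := κ) (stableConst α)).mul_right (‖z‖ ^ 2)).of_nonneg_of_le
    (fun j => by positivity) fun j => ?_
  rw [← mul_pow]
  simp only [ENNReal.toReal_ofNat, Real.rpow_two]
  gcongr
  exact abs_randomSeq_le hα0 hα2 hp1 hκ hlow z j

lemma randomOp_apply {z : SeqLp p} (h : Memℓp (fun j : ℕ => randomSeq α σ x ζ z j) 2) (j : ℕ) :
    randomOp p α σ x ζ z j = randomSeq α σ x ζ z j := by
  unfold randomOp
  rw [dif_pos h]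

lemma exists_norm_randomOp_le (hα0 : 0 < α) (hα2 : α < 2) (hp1 : 1 ≤ p) [IsProbabilityMeasure σ]
    (hκ : 0 < κ) (hlow : ∀ j : ℕ, 1 ≤ j → κ * j ≤ ∑ i ∈ Finset.range j, ζ i) :
    ∃ C, ∀ z : SeqLp p, ‖z‖ ≤ 1 → ‖randomOp p α σ x ζ z‖ ≤ C := by
  have hc := stableConst_pos hα0 hα2
  have hsum := summable_sq_rpow hα0 hα2 (κ := κ) (stableConst α)
  set D := ∑' j : ℕ, (stableConst α * (κ ^ (-1 / α) * ((j : ℝ) + 1) ^ (-1 / α))) ^ 2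
  have hD : 0 ≤ D := tsum_nonneg fun j => sq_nonneg _
  refine ⟨√D, fun z hz => lp.norm_le_of_tsum_le (by norm_num) (Real.sqrt_nonneg _) ?_⟩
  simp only [ENNReal.toReal_ofNat, Real.rpow_two]
  rw [Real.sq_sqrt hD]
  have hle : ∀ j, ‖randomOp p α σ x ζ z j‖ ^ 2 ≤
      (stableConst α * (κ ^ (-1 / α) * ((j : ℝ) + 1) ^ (-1 / α))) ^ 2 := by
    intro j
    rw [randomOp_apply (memℓp_randomSeq hα0 hα2 hp1 hκ hlow z)]
    gcongr
    refine (abs_randomSeq_le hα0 hα2 hp1 hκ hlow z j).trans ?_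
    exact mul_le_of_le_one_right (by positivity) hz
  exact (hsum.of_nonneg_of_le (fun j => sq_nonneg _) hle).tsum_le_tsum hle hsum

/-- The multiple `t · 1_S` of the indicator sequence of a finite set. -/
def indicatorSeq (p : ℝ≥0∞) (t : ℝ) (S : Finset ℕ) : SeqLp p :=
  ⟨fun k => if k ∈ S then t else 0, by
    refine (memℓp_zero ?_).of_exponent_ge zero_le
    refine S.finite_toSet.subset fun k hk => ?_
    by_contra h
    exact hk (if_neg h)⟩

lemma indicatorSeq_apply (t : ℝ) (S : Finset ℕ) (k : ℕ) :
    indicatorSeq p t S k = if k ∈ S then t else 0 := rfl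

lemma norm_indicatorSeq_le (hp1 : 1 ≤ p) (hp : p ≠ ∞) {n : ℕ} (hn : 1 ≤ n) {S : Finset ℕ}
    (hS : S.card ≤ n) : ‖indicatorSeq p ((n : ℝ) ^ (-1 / p.toReal)) S‖ ≤ 1 := by
  have hP : 0 < p.toReal := ENNReal.toReal_pos (one_pos.trans_le hp1).ne' hp
  have hn' : (0 : ℝ) < n := by exact_mod_cast hn
  refine lp.norm_le_of_tsum_le hP zero_le_one ?_
  rw [tsum_eq_sum (s := S) fun k hk => by
    rw [indicatorSeq_apply, if_neg hk, norm_zero, Real.zero_rpow hP.ne']]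
  calc ∑ k ∈ S, ‖indicatorSeq p ((n : ℝ) ^ (-1 / p.toReal)) S k‖ ^ p.toReal
      = ∑ k ∈ S, (n : ℝ)⁻¹ := by
        refine Finset.sum_congr rfl fun k hk => ?_
        rw [indicatorSeq_apply, if_pos hk, Real.norm_eq_abs, abs_of_pos (by positivity),
          ← Real.rpow_mul hn'.le, div_mul_cancel₀ _ hP.ne', Real.rpow_neg_one]
    _ = S.card * (n : ℝ)⁻¹ := by simp
    _ ≤ n * (n : ℝ)⁻¹ := by gcongr
    _ = 1 ^ p.toReal := by rw [mul_inv_cancel₀ hn'.ne', Real.one_rpow]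

/-- If `2n` distinct values occur among the first `m` draws, then the image of the unit ball
contains a `2n`-dimensional cube. -/
lemma le_entropyNumber_randomOp (hα0 : 0 < α) (hα2 : α < 2) (hp1 : 1 ≤ p) (hp : p ≠ ∞)
    [IsProbabilityMeasure σ] (hκ : 0 < κ)
    (hlow : ∀ j : ℕ, 1 ≤ j → κ * j ≤ ∑ i ∈ Finset.range j, ζ i) (hζ : ∀ i, 0 ≤ ζ i)
    {H : ℝ} {n m l : ℕ} (hn : 1 ≤ n) (hH : ∑ i ∈ Finset.range m, ζ i ≤ H)
    (hcard : 2 * n ≤ (tailValues l m x).card) :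
    stableConst α * (((2 * n : ℕ) : ℝ) ^ (-1 / p.toReal) * H ^ (-1 / α)) * √n / 6 ≤
      entropyNumber (randomOp p α σ x ζ) n := by
  have hc := stableConst_pos hα0 hα2
  obtain ⟨U, hU, hUcard⟩ := Finset.exists_subset_card_eq
    (hcard.trans (Finset.card_le_card (Finset.filter_subset _ _)))
  have hsurj : Set.SurjOn x (Finset.range m : Set ℕ) U := by
    intro k hk
    obtain ⟨j, hj, rfl⟩ := Finset.mem_image.1 (hU hk)
    exact ⟨j, hj, rfl⟩
  obtain ⟨A, hAm, hinj, hAU⟩ := Finset.exists_subset_injOn_image_eq_of_surjOn _ U hsurj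
  have hAcard : A.card = 2 * n := by rw [← hUcard, ← hAU, Finset.card_image_of_injOn hinj]
  set t : ℝ := ((2 * n : ℕ) : ℝ) ^ (-1 / p.toReal) with ht
  have ht0 : 0 ≤ t := by positivity
  have hmem : ∀ j ∈ A, ∀ S ⊆ A, (x j ∈ S.image x ↔ j ∈ S) := by
    intro j hj S hS
    refine ⟨fun h => ?_, Finset.mem_image_of_mem x⟩
    obtain ⟨i, hi, hij⟩ := Finset.mem_image.1 h
    rwa [← hinj (hS hi) hj hij]
  have hApos : 1 ≤ m := by
    by_contra hm
    have : A = ∅ := Finset.eq_empty_of_forall_notMem fun j hj => by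
      have := Finset.mem_range.1 (hAm hj)
      omega
    rw [this] at hAcard
    simp at hAcard
    omega
  have hHpos : 0 < H := by
    refine lt_of_lt_of_le ?_ ((hlow m hApos).trans hH)
    have : (0 : ℝ) < m := by exact_mod_cast hApos
    positivity
  refine le_entropyNumber_of_cube (exists_norm_randomOp_le hα0 hα2 hp1 hκ hlow) hn hAcard
    (fun S => indicatorSeq p t (S.image x)) (fun S hS => ?_) (by positivity) ?_
  · refine norm_indicatorSeq_le hp1 hp (by omega) ?_
    exact Finset.card_image_le.trans ((Finset.card_le_card hS).trans hAcard.le)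
  · intro S hS S' hS' j hj
    have hjA : j ∈ A := by
      rcases Finset.mem_symmDiff.1 hj with h | h
      · exact hS h.1
      · exact hS' h.1
    have hjm : j < m := Finset.mem_range.1 (hAm hjA)
    set g := ∑ i ∈ Finset.range (j + 1), ζ i with hg
    have hg0 : 0 < g := lt_of_lt_of_le (by positivity) (hlow (j + 1) (by omega))
    have hgH : g ≤ H := le_trans (Finset.sum_le_sum_of_subset_of_nonneg
      (Finset.range_mono hjm) fun i _ _ => hζ i) hH
    have hgp : H ^ (-1 / α) ≤ g ^ (-1 / α) :=
      Real.rpow_le_rpow_of_nonpos hg0 hgH (by rw [neg_div]; simp [hα0.le])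
    have hgp0 : 0 ≤ g ^ (-1 / α) := by positivity
    rw [randomOp_apply (memℓp_randomSeq hα0 hα2 hp1 hκ hlow _),
      randomOp_apply (memℓp_randomSeq hα0 hα2 hp1 hκ hlow _)]
    unfold randomSeq
    rw [probReal_univ, Real.one_rpow, mul_one, ← hg, ← mul_sub, ← sub_mul, abs_mul, abs_mul,
      abs_of_pos hc, abs_of_nonneg hgp0]
    have hdiff : |indicatorSeq p t (S.image x) (x j) - indicatorSeq p t (S'.image x) (x j)| = t := by
      rw [indicatorSeq_apply, indicatorSeq_apply]
      simp only [hmem j hjA S hS, hmem j hjA S' hS']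
      rcases Finset.mem_symmDiff.1 hj with h | h
      · rw [if_pos h.1, if_neg h.2, sub_zero, abs_of_nonneg ht0]
      · rw [if_neg h.2, if_pos h.1, zero_sub, abs_neg, abs_of_nonneg ht0]
    rw [hdiff]
    gcongr

end Realization

/-! ### Laws on the natural numbers with given hazard rates -/

/-- The mass of `[n, ∞)` under the law on `ℕ` with hazard rates `a`: a draw that is at least `k`
equals `k` with probability `a k`. -/
def tailMass (a : ℕ → ℝ) (n : ℕ) : ℝ := ∏ i ∈ Finset.range n, (1 - a i)

section TailMass

variable {a : ℕ → ℝ}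

lemma tailMass_zero : tailMass a 0 = 1 := by simp [tailMass]

lemma tailMass_succ (n : ℕ) : tailMass a (n + 1) = tailMass a n * (1 - a n) :=
  Finset.prod_range_succ _ _

lemma sum_tailMass_mul (n : ℕ) :
    ∑ k ∈ Finset.range n, tailMass a k * a k = 1 - tailMass a n := by
  induction n with
  | zero => simp [tailMass_zero]
  | succ n ih => rw [Finset.sum_range_succ, ih, tailMass_succ]; ring

lemma hazard_le_quarter (ha1 : ∀ k : ℕ, a k ≤ 1 / (4 * ((k : ℝ) + 1))) (k : ℕ) : a k ≤ 1 / 4 := by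
  refine (ha1 k).trans ?_
  have : (0 : ℝ) ≤ k := Nat.cast_nonneg k
  gcongr
  linarith

lemma tailMass_pos (ha1 : ∀ k : ℕ, a k ≤ 1 / (4 * ((k : ℝ) + 1))) (n : ℕ) : 0 < tailMass a n :=
  Finset.prod_pos fun i _ => by linarith [hazard_le_quarter ha1 i]

lemma tailMass_antitone (ha0 : ∀ k, 0 < a k) (ha1 : ∀ k : ℕ, a k ≤ 1 / (4 * ((k : ℝ) + 1))) :
    Antitone (tailMass a) :=
  antitone_nat_of_succ_le fun n => by
    rw [tailMass_succ]
    exact mul_le_of_le_one_right (tailMass_pos ha1 n).le (by linarith [ha0 n])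

lemma tailMass_mul_monotone (ha1 : ∀ k : ℕ, a k ≤ 1 / (4 * ((k : ℝ) + 1))) :
    Monotone fun n : ℕ => tailMass a n * ((n : ℝ) + 1) :=
  monotone_nat_of_le_succ fun n => by
    rw [tailMass_succ, mul_assoc]
    refine mul_le_mul_of_nonneg_left ?_ (tailMass_pos ha1 n).le
    have h := ha1 n
    have hn : (0 : ℝ) ≤ n := Nat.cast_nonneg n
    rw [le_div_iff₀ (by positivity)] at h
    push_cast
    nlinarith [hazard_le_quarter ha1 n]

lemma tendsto_tailMass (ha0 : ∀ k, 0 < a k) (ha1 : ∀ k : ℕ, a k ≤ 1 / (4 * ((k : ℝ) + 1)))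
    (hdiv : ¬ Summable a) : Tendsto (tailMass a) atTop (𝓝 0) := by
  have h1 := (not_summable_iff_tendsto_nat_atTop_of_nonneg fun k => (ha0 k).le).1 hdiv
  have h2 : Tendsto (fun n => Real.exp (-∑ i ∈ Finset.range n, a i)) atTop (𝓝 0) :=
    Real.tendsto_exp_atBot.comp (tendsto_neg_atTop_atBot.comp h1)
  refine squeeze_zero (fun n => (tailMass_pos ha1 n).le) (fun n => ?_) h2
  rw [← Finset.sum_neg_distrib, Real.exp_sum]
  refine Finset.prod_le_prod (fun i _ => by linarith [hazard_le_quarter ha1 i]) fun i _ => ?_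
  exact Real.one_sub_le_exp_neg _

/-- Divergence of the series of hazard rates is what makes the total mass equal to `1`. -/
lemma exists_measure_tailMass (ha0 : ∀ k, 0 < a k) (ha1 : ∀ k : ℕ, a k ≤ 1 / (4 * ((k : ℝ) + 1)))
    (hdiv : ¬ Summable a) : ∃ (σ : Measure ℕ) (_ : IsProbabilityMeasure σ),
      ∀ k, σ {k} = ENNReal.ofReal (tailMass a k * a k) := by
  have h0 : ∀ k, 0 ≤ tailMass a k * a k := fun k => (mul_pos (tailMass_pos ha1 k) (ha0 k)).le
  have hsum : HasSum (fun k => tailMass a k * a k) 1 := by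
    rw [hasSum_iff_tendsto_nat_of_nonneg h0]
    simp_rw [sum_tailMass_mul]
    simpa using (tendsto_tailMass ha0 ha1 hdiv).const_sub 1
  have h1 : HasSum (fun k => ENNReal.ofReal (tailMass a k * a k)) 1 := by
    rw [← ENNReal.ofReal_one, ← hsum.tsum_eq, ENNReal.ofReal_tsum_of_nonneg h0 hsum.summable]
    exact ENNReal.summable.hasSum
  let μ : PMF ℕ := ⟨_, h1⟩
  exact ⟨μ.toMeasure, inferInstance, fun k =>
    PMF.toMeasure_apply_singleton μ k (measurableSet_singleton k)⟩

variable {σ : Measure ℕ}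

lemma measureReal_singleton_eq (ha0 : ∀ k, 0 < a k)
    (ha1 : ∀ k : ℕ, a k ≤ 1 / (4 * ((k : ℝ) + 1)))
    (hσ : ∀ k, σ {k} = ENNReal.ofReal (tailMass a k * a k)) (k : ℕ) :
    σ.real {k} = tailMass a k * a k := by
  rw [Measure.real, hσ, ENNReal.toReal_ofReal (mul_pos (tailMass_pos ha1 k) (ha0 k)).le]

variable [IsProbabilityMeasure σ]

lemma measureReal_Ici_eq (ha0 : ∀ k, 0 < a k) (ha1 : ∀ k : ℕ, a k ≤ 1 / (4 * ((k : ℝ) + 1)))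
    (hσ : ∀ k, σ {k} = ENNReal.ofReal (tailMass a k * a k)) (n : ℕ) :
    σ.real (Set.Ici n) = tailMass a n := by
  have h1 : σ.real (Finset.range n : Set ℕ) = 1 - tailMass a n := by
    rw [← sum_measureReal_singleton, ← sum_tailMass_mul]
    exact Finset.sum_congr rfl fun k _ => measureReal_singleton_eq ha0 ha1 hσ k
  have h2 : (Set.Ici n : Set ℕ) = (Finset.range n : Set ℕ)ᶜ := by ext; simp
  rw [h2, probReal_compl_eq_one_sub MeasurableSet.of_discrete, h1]
  ring

lemma half_tailMass_le (ha0 : ∀ k, 0 < a k) (ha1 : ∀ k : ℕ, a k ≤ 1 / (4 * ((k : ℝ) + 1)))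
    (hanti : Antitone a)
    (hσ : ∀ k, σ {k} = ENNReal.ofReal (tailMass a k * a k)) {n : ℕ} {A : Finset ℕ}
    (hA : A.card < 2 * n) : tailMass a n / 2 ≤ σ.real (Set.Ici n \ A) := by
  set A' := A.filter (n ≤ ·) with hA'
  have hT := tailMass_pos ha1 n
  have h1 : (Set.Ici n \ A : Set ℕ) = Set.Ici n \ (A' : Set ℕ) := by
    ext k
    simp only [hA', Set.mem_sdiff, Set.mem_Ici, Finset.mem_coe, Finset.mem_filter]
    tauto
  have h2 : σ.real (A' : Set ℕ) ≤ tailMass a n / 2 := by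
    rw [← sum_measureReal_singleton]
    calc ∑ k ∈ A', σ.real {k} ≤ ∑ k ∈ A', tailMass a n * a n := by
          refine Finset.sum_le_sum fun k hk => ?_
          have hnk : n ≤ k := (Finset.mem_filter.1 hk).2
          rw [measureReal_singleton_eq ha0 ha1 hσ]
          exact mul_le_mul (tailMass_antitone ha0 ha1 hnk) (hanti hnk) (ha0 k).le hT.le
      _ = A'.card * (tailMass a n * a n) := by simp
      _ ≤ (2 * n : ℕ) * (tailMass a n * (1 / (4 * ((n : ℝ) + 1)))) := by
          have hA'card : (A'.card : ℝ) ≤ (2 * n : ℕ) := by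
            exact_mod_cast (Finset.card_filter_le _ _).trans hA.le
          exact mul_le_mul hA'card (mul_le_mul_of_nonneg_left (ha1 n) hT.le)
            (mul_pos hT (ha0 n)).le (Nat.cast_nonneg _)
      _ ≤ tailMass a n / 2 := by
          push_cast
          rw [mul_one_div, mul_div_assoc', div_le_div_iff₀ (by positivity) two_pos]
          nlinarith [Nat.cast_nonneg (α := ℝ) n]
  have h3 := le_measureReal_sdiff (μ := σ) (s₁ := Set.Ici n) (s₂ := (A' : Set ℕ))
  rw [measureReal_Ici_eq ha0 ha1 hσ] at h3
  rw [h1]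
  linarith

/-- Almost surely, for all large `n`, the first `⌈12 n / T n⌉` draws contain `2n` distinct
values `≥ n`, where `T n` is the probability of drawing a value `≥ n`. -/
lemma ae_eventually_le_card_tailValues (ha0 : ∀ k, 0 < a k)
    (ha1 : ∀ k : ℕ, a k ≤ 1 / (4 * ((k : ℝ) + 1))) (hanti : Antitone a)
    (hσ : ∀ k, σ {k} = ENNReal.ofReal (tailMass a k * a k))
    {Ω : Type*} [MeasurableSpace Ω] {Q : Measure Ω} [IsProbabilityMeasure Q] {V : ℕ → Ω → ℕ}
    (hVm : ∀ j, Measurable (V j)) (hVl : ∀ j, Q.map (V j) = σ) (hVi : iIndepFun V Q) :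
    ∀ᵐ ω ∂Q, ∀ᶠ n : ℕ in atTop,
      2 * n ≤ (tailValues n ⌈12 * n / tailMass a n⌉₊ (V · ω)).card := by
  have hbound : ∀ n : ℕ, Q {ω | (tailValues n ⌈12 * n / tailMass a n⌉₊ (V · ω)).card < 2 * n}
      ≤ ENNReal.ofReal ((1 / 4) ^ n) := by
    intro n
    have hT := tailMass_pos ha1 n
    have hT1 : tailMass a n ≤ 1 := by
      have := tailMass_antitone ha0 ha1 (Nat.zero_le n)
      rwa [tailMass_zero] at this
    refine (measure_card_tailValues_lt_le hVm hVl hVi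
      (fun A hA => half_tailMass_le ha0 ha1 hanti hσ hA) _).trans ?_
    rw [← ENNReal.ofReal_pow (by linarith),
      show (2 : ℝ≥0∞) ^ (2 * n) = ENNReal.ofReal (2 ^ (2 * n)) by
        rw [ENNReal.ofReal_pow two_pos.le]; simp, ← ENNReal.ofReal_mul (by positivity)]
    apply ENNReal.ofReal_le_ofReal
    set m := ⌈12 * n / tailMass a n⌉₊ with hm
    have h1 : (12 : ℝ) * n ≤ m * tailMass a n := (div_le_iff₀ hT).1 (Nat.le_ceil _)
    calc (2 : ℝ) ^ (2 * n) * (1 - tailMass a n / 2 / 2) ^ m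
        ≤ 2 ^ (2 * n) * Real.exp (-(tailMass a n / 2 / 2)) ^ m := by
          gcongr
          · linarith
          · exact Real.one_sub_le_exp_neg _
      _ = 4 ^ n * Real.exp (-(m * tailMass a n / 4)) := by
          rw [← Real.exp_nat_mul, pow_mul]
          ring_nf
      _ ≤ 4 ^ n * Real.exp (-(n * 3)) := by
          gcongr
          linarith
      _ = (4 * (Real.exp 1 ^ 3)⁻¹) ^ n := by
          rw [mul_pow, Real.exp_neg, ← Real.exp_nat_mul 1 3, inv_pow, ← Real.exp_nat_mul]
          norm_num
      _ ≤ (1 / 4) ^ n := by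
          gcongr
          rw [← div_eq_mul_inv, div_le_div_iff₀ (by positivity) (by norm_num)]
          have h2 : (2.7 : ℝ) ^ 3 ≤ Real.exp 1 ^ 3 := by
            gcongr
            linarith [Real.exp_one_gt_d9]
          norm_num at h2 ⊢
          linarith
  have hsum : ∑' n : ℕ, Q {ω | (tailValues n ⌈12 * n / tailMass a n⌉₊ (V · ω)).card < 2 * n}
      ≠ ∞ := by
    refine ne_top_of_le_ne_top ?_ (ENNReal.tsum_le_tsum hbound)
    rw [← ENNReal.ofReal_tsum_of_nonneg (fun n => by positivity)
      (summable_geometric_of_lt_one (by norm_num) (by norm_num))]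
    exact ENNReal.ofReal_ne_top
  filter_upwards [ae_eventually_notMem hsum] with ω hω
  filter_upwards [hω] with n hn
  exact not_lt.1 hn

end TailMass

/-! ### Weights coming from a doubling sequence -/

lemma exists_doubling_exponent {d : ℕ → ℝ} (hdpos : ∀ k, 1 ≤ k → 0 < d k)
    (hdmono : MonotoneOn d (Set.Ici 1)) (hddouble : d =Θ[atTop] fun n : ℕ => d (2 * n)) :
    ∃ γ : ℝ, 0 ≤ γ ∧ ∀ k, 1 ≤ k → d (2 * k) ≤ 2 ^ γ * d k := by
  obtain ⟨C, hC⟩ := hddouble.2.bound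
  obtain ⟨k₀, hk₀⟩ := eventually_atTop.1 hC
  set W := max 1 (max C (d (2 * (k₀ + 1)) / d 1)) with hW
  have hW1 : 1 ≤ W := le_max_left _ _
  refine ⟨Real.logb 2 W, Real.logb_nonneg (by norm_num) hW1, fun k hk => ?_⟩
  rw [Real.rpow_logb two_pos (by norm_num) (by linarith)]
  have hdk := hdpos k hk
  rcases le_total k₀ k with h | h
  · have h1 := hk₀ k h
    rw [Real.norm_eq_abs, Real.norm_eq_abs, abs_of_pos (hdpos _ (by omega)), abs_of_pos hdk] at h1
    refine h1.trans ?_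
    gcongr
    exact (le_max_left _ _).trans (le_max_right _ _)
  · have hd1 := hdpos 1 le_rfl
    calc d (2 * k) ≤ d (2 * (k₀ + 1)) :=
          hdmono (Set.mem_Ici.2 (by omega)) (Set.mem_Ici.2 (by omega)) (by omega)
      _ = d (2 * (k₀ + 1)) / d 1 * d 1 := by field_simp
      _ ≤ W * d k := by
          refine mul_le_mul ((le_max_right _ _).trans (le_max_right _ _))
            (hdmono (Set.mem_Ici.2 le_rfl) (Set.mem_Ici.2 hk) hk) hd1.le (by linarith)

lemma le_rpow_mul_of_doubling {d : ℕ → ℝ} (hdpos : ∀ k, 1 ≤ k → 0 < d k)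
    (hdmono : MonotoneOn d (Set.Ici 1)) {γ : ℝ} (hγ : 0 ≤ γ)
    (hd : ∀ k, 1 ≤ k → d (2 * k) ≤ 2 ^ γ * d k) {k n : ℕ} (hk : 1 ≤ k) (hkn : k ≤ n) :
    d n ≤ 2 ^ γ * ((n : ℝ) / k) ^ γ * d k := by
  induction hN : n - k using Nat.strong_induction_on generalizing k with
  | _ N ih =>
    have hk' : (0 : ℝ) < k := by exact_mod_cast hk
    have hdk := hdpos k hk
    rcases lt_or_ge n (2 * k) with h | h
    · have h1 : 1 ≤ ((n : ℝ) / k) ^ γ := by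
        refine Real.one_le_rpow ?_ hγ
        rw [one_le_div hk']
        exact_mod_cast hkn
      calc d n ≤ d (2 * k) :=
            hdmono (Set.mem_Ici.2 (by omega)) (Set.mem_Ici.2 (by omega)) h.le
        _ ≤ 2 ^ γ * 1 * d k := by rw [mul_one]; exact hd k hk
        _ ≤ _ := by gcongr
    · have h1 := ih (n - 2 * k) (by omega) (k := 2 * k) (by omega) h rfl
      calc d n ≤ 2 ^ γ * ((n : ℝ) / (2 * k : ℕ)) ^ γ * d (2 * k) := h1
        _ ≤ 2 ^ γ * ((n : ℝ) / (2 * k : ℕ)) ^ γ * (2 ^ γ * d k) := by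
            gcongr
            exact hd k hk
        _ = 2 ^ γ * (((n : ℝ) / (2 * k : ℕ)) ^ γ * 2 ^ γ) * d k := by ring
        _ = _ := by
            rw [← Real.mul_rpow (by positivity) two_pos.le]
            congr 3
            push_cast
            field_simp

section Weights

variable {a h : ℕ → ℝ}

lemma tailMass_mul_le_of_ge (ha0 : ∀ k, 0 < a k)
    (ha1 : ∀ k : ℕ, a k ≤ 1 / (4 * ((k : ℝ) + 1))) (hah : ∀ k : ℕ, a k = h k / ((k : ℝ) + 1))
    (hh : Antitone h) {n k : ℕ} (hn : 1 ≤ n) (hk : n ≤ k) :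
    tailMass a k * a k ≤ tailMass a (n - 1) * a (n - 1) * (((k : ℝ) + 1) / n)⁻¹ := by
  obtain ⟨i, rfl⟩ : ∃ i, n = i + 1 := ⟨n - 1, by omega⟩
  have hT := tailMass_pos ha1 i
  have hhk : 0 < h k := by
    have := ha0 k
    rw [hah] at this
    exact (div_pos_iff_of_pos_right (by positivity)).1 this
  rw [Nat.add_sub_cancel, hah, hah, inv_div]
  push_cast
  calc tailMass a k * (h k / ((k : ℝ) + 1)) ≤ tailMass a i * (h i / ((k : ℝ) + 1)) := by
        refine mul_le_mul (tailMass_antitone ha0 ha1 (by omega)) ?_ (by positivity) hT.le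
        exact div_le_div_of_nonneg_right (hh (by omega)) (by positivity)
    _ = _ := by field_simp

lemma tailMass_mul_le_of_le (ha0 : ∀ k, 0 < a k)
    (ha1 : ∀ k : ℕ, a k ≤ 1 / (4 * ((k : ℝ) + 1))) (hah : ∀ k : ℕ, a k = h k / ((k : ℝ) + 1))
    {C θ : ℝ} (hgrow : ∀ k i : ℕ, k ≤ i → h k ≤ C * (((i : ℝ) + 1) / (k + 1)) ^ θ * h i)
    {n k : ℕ} (hk : k < n) :
    tailMass a k * a k ≤
      C * (((k : ℝ) + 1) / n) ^ (-(θ + 2)) * (tailMass a (n - 1) * a (n - 1)) := by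
  obtain ⟨i, rfl⟩ : ∃ i, n = i + 1 := ⟨n - 1, by omega⟩
  have hT := tailMass_pos ha1 i
  have hhpos : ∀ k, 0 < h k := fun k => by
    have := ha0 k
    rw [hah] at this
    exact (div_pos_iff_of_pos_right (by positivity)).1 this
  rw [Nat.add_sub_cancel, hah, hah]
  push_cast
  have hki : k ≤ i := by omega
  have h1 : tailMass a k ≤ tailMass a i * (((i : ℝ) + 1) / (k + 1)) := by
    rw [mul_div_assoc', le_div_iff₀ (by positivity)]
    exact tailMass_mul_monotone ha1 hki
  set R : ℝ := ((i : ℝ) + 1) / (k + 1) with hR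
  have hR0 : 0 < R := by positivity
  have h2 : (((k : ℝ) + 1) / (i + 1)) ^ (-(θ + 2)) = R ^ θ * R ^ 2 := by
    rw [← Real.rpow_two, ← Real.rpow_add hR0, hR, ← inv_div, Real.inv_rpow (by positivity),
      Real.rpow_neg (by positivity), inv_inv]
  rw [h2]
  calc tailMass a k * (h k / ((k : ℝ) + 1))
      ≤ tailMass a i * R * (C * R ^ θ * h i / ((k : ℝ) + 1)) := by
        have hk0 := hhpos k
        refine mul_le_mul h1 ?_ (by positivity) (by positivity)
        exact div_le_div_of_nonneg_right (hgrow k i hki) (by positivity)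
    _ = C * (R ^ θ * R ^ 2) * (tailMass a i * (h i / ((i : ℝ) + 1))) := by
        rw [hR]; field_simp

end Weights

lemma rpow_le_mul_rpow {n N L : ℝ} (x : ℝ) (hn : 0 < n) (hL : 1 ≤ L) (hnN : n ≤ N)
    (hNn : N ≤ L * n) : n ^ x ≤ L ^ |x| * N ^ x := by
  have hN : 0 < N := hn.trans_le hnN
  rcases le_total 0 x with hx | hx
  · calc n ^ x ≤ 1 * N ^ x := by rw [one_mul]; gcongr
      _ ≤ L ^ |x| * N ^ x := by
          gcongr
          exact Real.one_le_rpow hL (abs_nonneg _)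
  · have hL0 : 0 < L := by linarith
    calc n ^ x ≤ (N / L) ^ x := by
          refine Real.rpow_le_rpow_of_nonpos (by positivity) ?_ hx
          rw [div_le_iff₀ hL0]; linarith
      _ = L ^ |x| * N ^ x := by
          rw [Real.div_rpow hN.le hL0.le, abs_of_nonpos hx, Real.rpow_neg hL0.le]
          field_simp

/-- The upper bound for the entropy numbers of the embedding, in terms of the weight at the index
itself. -/
lemma exists_entropyNumber_embeddingLp_le {α : ℝ} (hα0 : 0 < α) (hα2 : α < 2) {p : ℝ≥0∞}
    (hp1 : 1 ≤ p) (hp : p ≠ ∞) {a h : ℕ → ℝ} (ha0 : ∀ k, 0 < a k)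
    (ha1 : ∀ k : ℕ, a k ≤ 1 / (4 * ((k : ℝ) + 1))) (hah : ∀ k : ℕ, a k = h k / ((k : ℝ) + 1))
    (hh : Antitone h) {C θ : ℝ} (hC : 0 < C) (hθ : 0 ≤ θ)
    (hgrow : ∀ k i : ℕ, k ≤ i → h k ≤ C * (((i : ℝ) + 1) / (k + 1)) ^ θ * h i)
    {σ : Measure ℕ} [IsProbabilityMeasure σ]
    (hσ : ∀ k, σ {k} = ENNReal.ofReal (tailMass a k * a k)) :
    ∃ C' : ℝ, 0 < C' ∧ ∀ᶠ N : ℕ in atTop, entropyNumber (embeddingLp p α σ) N ≤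
      C' * (tailMass a N * a N * (N : ℝ) ^ (1 - α / p.toReal)) ^ (1 / α) := by
  have hs0 : ∀ k, 0 < tailMass a k * a k := fun k => mul_pos (tailMass_pos ha1 k) (ha0 k)
  obtain ⟨L, C₁, hL, hC₁, hle⟩ := entropyNumber_embeddingLp_le (γ := θ + 2) hα0 hα2 hp1 hp hC.le
  have hL' : (1 : ℝ) ≤ L := by exact_mod_cast hL
  set x := 1 - α / p.toReal with hx
  set W : ℝ := C * (3 * L) ^ (θ + 2) * (2 * L) ^ |x| with hW
  have hWpos : 0 < W := by positivity
  refine ⟨C₁ * W ^ (1 / α), by positivity, ?_⟩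
  filter_upwards [eventually_ge_atTop (L + 1)] with N hN
  set n := (N - 1) / L with hn
  have hn1 : 1 ≤ n := (Nat.le_div_iff_mul_le hL).2 (by omega)
  have hnL : L * n ≤ N - 1 := Nat.mul_div_le _ _
  have hNL : N ≤ 2 * L * n := by
    have h1 : N - 1 < L * (n + 1) := by
      rw [mul_comm]; exact Nat.lt_mul_of_div_lt (Nat.lt_succ_self _) hL
    have h2 : L ≤ L * n := Nat.le_mul_of_pos_right L hn1
    rw [mul_add, mul_one] at h1
    rw [mul_assoc]
    omega
  have hn0 : (0 : ℝ) < n := by exact_mod_cast hn1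
  have hnN : n ≤ N := (Nat.div_le_self _ _).trans (Nat.sub_le _ _)
  have h1 := hle σ _ (fun k => (hs0 k).le) hσ n _ hn1 (hs0 (n - 1))
    (fun k hk => tailMass_mul_le_of_le ha0 ha1 hah hgrow hk)
    (fun k hk => tailMass_mul_le_of_ge ha0 ha1 hah hh hn1 hk) N hnL
  refine h1.trans ?_
  rw [mul_assoc C₁, ← Real.mul_rpow hWpos.le (mul_nonneg (hs0 N).le (by positivity))]
  have hsN := hs0 N
  have hsn := hs0 (n - 1)
  refine mul_le_mul_of_nonneg_left (Real.rpow_le_rpow (mul_nonneg hsn.le (by positivity)) ?_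
    (by positivity)) hC₁.le
  have h2 := tailMass_mul_le_of_le ha0 ha1 hah hgrow (n := N + 1) (k := n - 1) (by omega)
  have hcast : ((n - 1 : ℕ) : ℝ) + 1 = n := by
    rw [Nat.cast_sub hn1]; simp
  rw [hcast, Nat.add_sub_cancel] at h2
  have h3 : ((n : ℝ) / (N + 1 : ℕ)) ^ (-(θ + 2)) ≤ (3 * L) ^ (θ + 2) := by
    rw [Real.rpow_neg (by positivity), ← Real.inv_rpow (by positivity), inv_div]
    refine Real.rpow_le_rpow (by positivity) ?_ (by linarith)
    rw [div_le_iff₀ hn0]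
    have : N + 1 ≤ 3 * L * n := by nlinarith
    exact_mod_cast this
  have h4 : (n : ℝ) ^ x ≤ (2 * L) ^ |x| * (N : ℝ) ^ x :=
    rpow_le_mul_rpow x hn0 (by linarith) (by exact_mod_cast hnN) (by exact_mod_cast hNL)
  calc tailMass a (n - 1) * a (n - 1) * (n : ℝ) ^ x
      ≤ C * (3 * L) ^ (θ + 2) * (tailMass a N * a N) * ((2 * L) ^ |x| * (N : ℝ) ^ x) := by
        refine mul_le_mul (h2.trans (mul_le_mul_of_nonneg_right ?_ hsN.le)) h4 (by positivity)
          (mul_nonneg (by positivity) hsN.le)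
        gcongr
    _ = W * (tailMass a N * a N * (N : ℝ) ^ x) := by rw [hW]; ring

/-! ### Asymptotics of the random input and the comparison -/

/-- Almost surely the partial sums `Γ_j` are of exact order `j`. -/
lemma ae_exists_linear_bounds {Ω : Type*} [MeasurableSpace Ω] {Q : Measure Ω}
    [IsProbabilityMeasure Q] {ζ : ℕ → Ω → ℝ} (hm : ∀ j, Measurable (ζ j))
    (hl : ∀ j, Q.map (ζ j) = expMeasure 1) (hi : iIndepFun ζ Q) :
    ∀ᵐ ω ∂Q, (∀ i, 0 < ζ i ω) ∧ ∃ κ M : ℝ, 0 < κ ∧ 0 < M ∧ ∀ j : ℕ, 1 ≤ j →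
      κ * j ≤ ∑ i ∈ Finset.range j, ζ i ω ∧ ∑ i ∈ Finset.range j, ζ i ω ≤ M * j := by
  have hpos : ∀ᵐ ω ∂Q, ∀ i, 0 < ζ i ω := by
    rw [ae_all_iff]
    intro i
    have h := ae_pos_expMeasure
    rw [← hl i] at h
    exact ae_of_ae_map (hm i).aemeasurable h
  have hint : Integrable (ζ 0) Q := by
    have h := integrable_id_expMeasure
    rw [← hl 0] at h
    exact h.comp_measurable (hm 0)
  have hmean : 0 < ∫ ω, ζ 0 ω ∂Q := by
    rw [integral_pos_iff_support_of_nonneg_ae (hpos.mono fun ω h => (h 0).le) hint]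
    have h : Q (Function.support (ζ 0)) = 1 := by
      rw [← prob_compl_eq_zero_iff (measurableSet_support (hm 0))]
      exact measure_mono_null (t := {ω | ¬ ∀ i, 0 < ζ i ω}) (fun ω hω h => hω (h 0).ne')
        (ae_iff.1 hpos)
    rw [h]
    exact one_pos
  have hslln := strong_law_ae_real ζ hint (fun i j hij => hi.indepFun hij)
    fun i => ⟨(hm i).aemeasurable, (hm 0).aemeasurable, by rw [hl, hl]⟩
  filter_upwards [hpos, hslln] with ω h1 h2
  refine ⟨h1, exists_linear_bounds (fun j hj => ?_) hmean h2⟩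
  exact Finset.sum_pos (fun i _ => h1 i) ⟨0, Finset.mem_range.2 hj⟩

/-- Comparison of the two entropy bounds: if the weight `w` is at most the tail mass `T` times a
hazard rate of order `D ^ (-α) / n`, then the upper bound for `e_n(u)`, multiplied by
`D n ^ (-1/α + 1/2)`, is dominated by the lower bound for `e_n(v)`. -/
lemma mul_gap_denominator_le {α P c T D w : ℝ} (hα0 : 0 < α) (hc : 0 < c) (hT : 0 < T)
    (hD : 0 < D) {n : ℕ} (hn : 1 ≤ n) (hw0 : 0 ≤ w) (hw : w ≤ T * (c * D ^ (-α)) / n) :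
    D * ((n : ℝ) ^ (-1 / α + 1 / 2) * (w * (n : ℝ) ^ (1 - α / P)) ^ (1 / α)) ≤
      c ^ (1 / α) * ((n : ℝ) ^ (-1 / P) * ((n : ℝ) ^ (-1 / α) * T ^ (1 / α))) * √n := by
  have hn' : (0 : ℝ) < n := by exact_mod_cast hn
  have h1 : w * (n : ℝ) ^ (1 - α / P) ≤ T * (c * D ^ (-α)) * (n : ℝ) ^ (-α / P) := by
    calc w * (n : ℝ) ^ (1 - α / P) ≤ T * (c * D ^ (-α)) / n * (n : ℝ) ^ (1 - α / P) := by gcongr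
      _ = _ := by
        rw [show 1 - α / P = 1 + -α / P by ring, Real.rpow_add hn', Real.rpow_one]
        field_simp
  have h2 : (w * (n : ℝ) ^ (1 - α / P)) ^ (1 / α)
      ≤ T ^ (1 / α) * (c ^ (1 / α) * D⁻¹) * (n : ℝ) ^ (-1 / P) := by
    calc _ ≤ (T * (c * D ^ (-α)) * (n : ℝ) ^ (-α / P)) ^ (1 / α) := by gcongr
      _ = _ := by
        rw [Real.mul_rpow (by positivity) (by positivity), Real.mul_rpow hT.le (by positivity),
          Real.mul_rpow hc.le (by positivity), ← Real.rpow_mul hD.le, ← Real.rpow_mul hn'.le]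
        have e1 : -α * (1 / α) = -1 := by field_simp
        have e2 : -α / P * (1 / α) = -1 / P := by field_simp
        rw [e1, e2, Real.rpow_neg_one]
  calc _ ≤ D * ((n : ℝ) ^ (-1 / α + 1 / 2)
        * (T ^ (1 / α) * (c ^ (1 / α) * D⁻¹) * (n : ℝ) ^ (-1 / P))) := by gcongr
    _ = _ := by
      rw [Real.rpow_add hn', ← Real.sqrt_eq_rpow]
      field_simp

theorem proposition6p4 (α : ℝ) (hα0 : 0 < α) (hα2 : α < 2)
    (d : ℕ → ℝ) (hdpos : ∀ k, 1 ≤ k → 0 < d k) (hdmono : MonotoneOn d (Set.Ici 1))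
    (hddouble : d =Θ[atTop] fun n : ℕ => d (2 * n))
    (hddiv : ¬ Summable fun k : ℕ => d k ^ (-α) / (k : ℝ))
    (hdlog : (fun k : ℕ => Real.log k ^ (1 / (2 * α))) =O[atTop] d)
    (p : ℝ≥0∞) (hp1 : 1 ≤ p) (hp : p ≠ ∞) :
    ∃ (σ : Measure ℕ) (_ : IsProbabilityMeasure σ),
      (∀ k, 0 < σ {k}) ∧ (Antitone fun k => σ {k}) ∧
      ∀ (Ω : Type*) (_ : MeasurableSpace Ω) (Q : Measure Ω) (_ : IsProbabilityMeasure Q)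
        (V : ℕ → Ω → ℕ) (ζ : ℕ → Ω → ℝ), IsRandomInput Q σ V ζ →
        ∀ᵐ ω ∂Q,
          (∀ z : SeqLp p, Memℓp (fun j : ℕ => randomSeq α σ (V · ω) (ζ · ω) z j) 2) ∧
          d =O[atTop] fun n : ℕ => entropyGap p α σ (V · ω) (ζ · ω) n := by
  obtain ⟨γ, hγ, hd⟩ := exists_doubling_exponent hdpos hdmono hddouble
  have hd1 := hdpos 1 le_rfl
  -- With this constant the hazard rates satisfy `a k ≤ 1 / (4 (k + 1))`, so that fewer than `2n`
  -- atoms beyond `n` carry at most half of the mass of `[n, ∞)`.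
  set c : ℝ := d 1 ^ α / 4 with hc
  have hcpos : 0 < c := by positivity
  let h : ℕ → ℝ := fun k => c * d (k + 1) ^ (-α)
  let a : ℕ → ℝ := fun k => h k / ((k : ℝ) + 1)
  have hdk : ∀ k, 0 < d (k + 1) := fun k => hdpos _ (by omega)
  have hh0 : ∀ k, 0 < h k := fun k => mul_pos hcpos (Real.rpow_pos_of_pos (hdk k) _)
  have hh : Antitone h := fun k i hki => by
    refine mul_le_mul_of_nonneg_left ?_ hcpos.le
    exact Real.rpow_le_rpow_of_nonpos (hdk k)
      (hdmono (Set.mem_Ici.2 (by omega)) (Set.mem_Ici.2 (by omega)) (by omega)) (by linarith)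
  have hh1 : ∀ k, h k ≤ 1 / 4 := fun k => by
    refine (hh (Nat.zero_le k)).trans_eq ?_
    simp only [h, hc, zero_add]
    rw [Real.rpow_neg hd1.le]
    field_simp
  have ha0 : ∀ k, 0 < a k := fun k => div_pos (hh0 k) (by positivity)
  have ha1 : ∀ k : ℕ, a k ≤ 1 / (4 * ((k : ℝ) + 1)) := fun k => by
    rw [← div_div]
    exact div_le_div_of_nonneg_right (hh1 k) (by positivity)
  have hanti : Antitone a := fun k i hki =>
    div_le_div₀ (hh0 k).le (hh hki) (by positivity) (by gcongr)
  have hdiv : ¬ Summable a := by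
    intro hs
    refine hddiv ((summable_nat_add_iff 1).1 ((hs.mul_left c⁻¹).congr fun k => ?_))
    simp only [a, h]
    push_cast
    field_simp
  have hgrow : ∀ k i : ℕ, k ≤ i →
      h k ≤ 2 ^ (γ * α) * (((i : ℝ) + 1) / (k + 1)) ^ (γ * α) * h i := by
    intro k i hki
    have e1 := le_rpow_mul_of_doubling hdpos hdmono hγ hd (k := k + 1) (n := i + 1)
      (by omega) (by omega)
    push_cast at e1
    set R : ℝ := ((i : ℝ) + 1) / (k + 1) with hR
    have hR0 : 0 < R := by positivity
    have hk0 := hdk k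
    have hi0 := hdk i
    have e2 : d (i + 1) ^ α ≤ 2 ^ (γ * α) * R ^ (γ * α) * d (k + 1) ^ α := by
      calc d (i + 1) ^ α ≤ (2 ^ γ * R ^ γ * d (k + 1)) ^ α := by gcongr
        _ = _ := by
          rw [Real.mul_rpow (by positivity) hk0.le, Real.mul_rpow (by positivity) (by positivity),
            ← Real.rpow_mul two_pos.le, ← Real.rpow_mul hR0.le]
    simp only [h]
    rw [Real.rpow_neg hk0.le, Real.rpow_neg hi0.le, mul_left_comm]
    refine mul_le_mul_of_nonneg_left ?_ hcpos.le
    rw [← div_eq_mul_inv, le_div_iff₀ (by positivity), inv_mul_le_iff₀ (by positivity)]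
    linarith
  obtain ⟨σ, hσp, hσ⟩ := exists_measure_tailMass ha0 ha1 hdiv
  have hσpos : ∀ k, 0 < σ {k} := fun k => by
    rw [hσ, ENNReal.ofReal_pos]
    exact mul_pos (tailMass_pos ha1 k) (ha0 k)
  refine ⟨σ, hσp, hσpos, fun k i hki => ?_, ?_⟩
  · simp only [hσ]
    exact ENNReal.ofReal_le_ofReal (mul_le_mul (tailMass_antitone ha0 ha1 hki) (hanti hki)
      (ha0 i).le (tailMass_pos ha1 k).le)
  intro Ω _ Q _ V ζ hin
  obtain ⟨C, hC, hup⟩ := exists_entropyNumber_embeddingLp_le hα0 hα2 hp1 hp ha0 ha1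
    (fun _ => rfl) hh (by positivity) (by positivity) hgrow hσ
  filter_upwards [ae_exists_linear_bounds hin.measurable_ζ hin.law_ζ hin.iIndep_ζ,
    ae_eventually_le_card_tailValues ha0 ha1 hanti hσ hin.measurable_V hin.law_V hin.iIndep_V]
    with ω hΓ hcard
  obtain ⟨hζ, κ, M, hκ, hM, hbd⟩ := hΓ
  have hlow : ∀ j : ℕ, 1 ≤ j → κ * j ≤ ∑ i ∈ Finset.range j, ζ i ω := fun j hj => (hbd j hj).1
  refine ⟨fun z => memℓp_randomSeq hα0 hα2 hp1 hκ hlow z, ?_⟩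
  have hsc := stableConst_pos hα0 hα2
  set P := p.toReal with hP
  set K₁ : ℝ := stableConst α * ((2 : ℝ) ^ (-1 / P) * (13 * M) ^ (-1 / α)) / 6 with hK₁
  have hK₁pos : 0 < K₁ := by positivity
  refine IsBigO.of_bound (C * c ^ (1 / α) / K₁) ?_
  filter_upwards [hcard, hup, eventually_ge_atTop 1] with n hn1 hn2 hn
  have hn' : (0 : ℝ) < n := by exact_mod_cast hn
  have hn1' : (1 : ℝ) ≤ n := by exact_mod_cast hn
  have hT := tailMass_pos ha1 n
  have hT1 : tailMass a n ≤ 1 := by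
    have := tailMass_antitone ha0 ha1 (Nat.zero_le n)
    rwa [tailMass_zero] at this
  set T := tailMass a n with hTdef
  set m := ⌈12 * n / T⌉₊ with hm
  have hm1 : (m : ℝ) ≤ 13 * n / T := by
    have e1 : (m : ℝ) ≤ 12 * n / T + 1 := (Nat.ceil_lt_add_one (by positivity)).le
    have e2 : 1 ≤ n / T := by rw [one_le_div hT]; linarith
    calc (m : ℝ) ≤ 12 * n / T + n / T := e1.trans (by gcongr)
      _ = _ := by ring
  have hmpos : 1 ≤ m := Nat.one_le_iff_ne_zero.2 (Nat.ceil_pos.2 (by positivity)).ne'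
  have hH : ∑ i ∈ Finset.range m, ζ i ω ≤ 13 * M * (n / T) :=
    calc _ ≤ M * m := (hbd m hmpos).2
      _ ≤ M * (13 * n / T) := by gcongr
      _ = _ := by ring
  have hev := le_entropyNumber_randomOp hα0 hα2 hp1 hp (σ := σ) hκ hlow (fun i => (hζ i).le) hn
    hH hn1
  have hlower : K₁ * (((n : ℝ) ^ (-1 / P) * ((n : ℝ) ^ (-1 / α) * T ^ (1 / α))) * √n) ≤
      entropyNumber (randomOp p α σ (V · ω) (ζ · ω)) n := by
    refine le_trans (le_of_eq ?_) hev
    have e1 : (n / T) ^ (-1 / α) = (n : ℝ) ^ (-1 / α) * T ^ (1 / α) := by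
      rw [Real.div_rpow hn'.le hT.le, div_eq_mul_inv, ← Real.rpow_neg hT.le]
      congr 2
      ring
    push_cast
    rw [Real.mul_rpow two_pos.le hn'.le, Real.mul_rpow (by positivity) (by positivity), e1, hK₁]
    ring
  have heu := entropyNumber_embeddingLp_pos hα0 hp1 hσpos n
  have hdn := hdpos n hn
  have hw : T * a n ≤ T * (c * d n ^ (-α)) / n := by
    rw [mul_div_assoc]
    refine mul_le_mul_of_nonneg_left ?_ hT.le
    refine div_le_div₀ (by positivity) ?_ hn' (by linarith)
    refine mul_le_mul_of_nonneg_left ?_ hcpos.le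
    exact Real.rpow_le_rpow_of_nonpos hdn
      (hdmono (Set.mem_Ici.2 hn) (Set.mem_Ici.2 (by omega)) (by omega)) (by linarith)
  have hcomp := mul_gap_denominator_le (P := P) hα0 hcpos hT hdn hn
    (mul_pos hT (ha0 n)).le hw
  have hgap0 : 0 ≤ entropyGap p α σ (V · ω) (ζ · ω) n :=
    div_nonneg (entropyNumber_nonneg _ _) (mul_nonneg (by positivity) heu.le)
  rw [Real.norm_eq_abs, Real.norm_eq_abs, abs_of_pos hdn, abs_of_nonneg hgap0]
  unfold entropyGap
  rw [mul_div_assoc', le_div_iff₀ (by positivity)]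
  calc d n * ((n : ℝ) ^ (-1 / α + 1 / 2) * entropyNumber (embeddingLp p α σ) n)
      ≤ d n * ((n : ℝ) ^ (-1 / α + 1 / 2) *
        (C * (T * a n * (n : ℝ) ^ (1 - α / P)) ^ (1 / α))) := by gcongr
    _ = C * (d n * ((n : ℝ) ^ (-1 / α + 1 / 2) *
        (T * a n * (n : ℝ) ^ (1 - α / P)) ^ (1 / α))) := by ring
    _ ≤ C * (c ^ (1 / α) * ((n : ℝ) ^ (-1 / P) * ((n : ℝ) ^ (-1 / α) * T ^ (1 / α))) * √n) := by
        gcongr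
    _ = C * c ^ (1 / α) / K₁ *
        (K₁ * (((n : ℝ) ^ (-1 / P) * ((n : ℝ) ^ (-1 / α) * T ^ (1 / α))) * √n)) := by
        field_simp
    _ ≤ _ := by gcongr
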